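/- **Setting.** Consider the memoryless fading channel with complex input $X$ and output $[Y,S_R]$, $Y=HX+Z$, where $(S_R,H)$ has a given joint law with $\mathbb E|H|^2=1$ and $S_R$ takes values in a standard Borel space. The noise $Z\sim\mathcal{CN}(0,1)$ has density $e^{-|z|^2}/\pi$ and is independent of $(S_R,H)$ and of the message. The receiver knows $S_R$ (CSIR). The transmitter knows $S_T=f_T(S_R)$ causally (CSIT), where $f_T$ is a measurable function. In a block code of length $n$ with $M$ messages, $X_i$ is a function of the message and $S_T^i=(S_{T1},\dots,S_{Ti})$, and the decoder sees $(Y^n,S_R^n)$. The power constraint is $\frac1n\sum_{i=1}^n\mathbb E|X_i|^2\le P$, where the expectation is also over the uniformly distributed message. A rate $r$ (in nats per channel use) is achievable if for every $\epsilon>0$ and all sufficiently large $n$ there is such a code with $M\ge e^{n(r-\epsilon)}$ and average error probability at most $\epsilon$. Put $$\tilde g(s_R)=|\mathbb E[H\mid S_R=s_R]|^2,\qquad \tilde\sigma^2(s_R)=\mathrm{Var}[H\mid S_R=s_R].$$ A power policy is a measurable function $s_T\mapsto P(s_T)\ge 0$ with $\mathbb E[P(S_T)]<\infty$. For a power policy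 let $X=\sqrt{P(S_T)}\,U$ with $U\sim\mathcal{CN}(0,1)$ independent of $(S_R,H,Z)$. For measurable functions $a(s_R)\in\mathbb C$ and $v(s_R)>0$ let $q(y|x,s_R)=\frac{1}{\pi v(s_R)}e^{-|y-a(s_R)x|^2/v(s_R)}$, let $q(y|s_R)=\mathbb E\big[q\big(y\,\big|\,\sqrt{P(f_T(s_R))}\,U,\,s_R\big)\big]$, and consider the generalized mutual information $\mathbb E\big[\log\frac{q(Y|X,S_R)}{q(Y|S_R)}\big]$ for those $(a,v)$ for which the logarithm is integrable. Let $I_1(X;Y|S_R)$ be its maximum over $(a,v)$. **Theorem.** 1. For every power policy with $\mathbb E[P(S_T)]=P$, the maximum $I_1(X;Y|S_R)$ exists, equals the finite number $$I_1(X;Y|S_R)=\mathbb E\left[\log\left(1+\frac{\tilde g(S_R)P(S_T)}{1+\tilde\sigma^2(S_R)P(S_T)}\right)\right],$$ and is an achievable rate under the power constraint $P$. 2. Let $P>0$. Call a power policy with $\mathbb E[P(S_T)]=P$ optimal if it maximizes the rate in part 1 among all power policies of mean at most $P$. An optimal policy exists. A power policy with $\mathbb E[P(S_T)]=P$ is optimal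 if and only if there is $\lambda\ge0$ such that, for almost every $s_T$, $$\lambda=\mathbb E\left[\left.\frac{\tilde g(S_R)}{\big[1+(\tilde g(S_R)+\tilde\sigma^2(S_R))P(s_T)\big]\big[1+\tilde\sigma^2(S_R)P(s_T)\big]}\,\right|\,S_T=s_T\right]\quad\text{if }P(s_T)>0,$$ and $\mathbb E[\tilde g(S_R)\mid S_T=s_T]\le\lambda$ if $P(s_T)=0$. 3. Let $P>0$, suppose that $S_T$ determines $S_R$ (i.e. $S_R$ is almost surely a measurable function of $S_T$), and suppose that $\tilde g(S_R)$ is not almost surely zero. A power policy with $\mathbb E[P(S_T)]=P$ is optimal if and only if there is $\lambda>0$ such that, for almost every $s_R$ and with $s_T=f_T(s_R)$, $$f\big(P(s_T),\tilde g(s_R),\tilde\sigma^2(s_R)\big)=\left(\frac1\lambda-\frac1{\tilde g(s_R)}\right)^+\ \text{ if }\tilde g(s_R)>0,\qquad P(s_T)=0\ \text{ if }\tilde g(s_R)=0,$$ where $(x)^+=\max(x,0)$ and $$f(Q,g,\sigma^2)=\left(1+2\frac{\sigma^2}{g}\right)Q+\left(1+\frac{\sigma^2}{g}\right)\sigma^2Q^2.$$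 -/

import Mathlib

open MeasureTheory ProbabilityTheory Filter

noncomputable section

/-- The law `CN(0,1)` on `ℂ`, given by its density `exp (-|z|²) / π`. -/
def cscg : Measure ℂ :=
  volume.withDensity fun z => ENNReal.ofReal (Real.exp (-‖z‖ ^ 2) / Real.pi)

/-- A memoryless fading channel `Y = H X + Z` with CSIR `S_R` taking values in `R` and CSIT
`S_T = csit S_R` taking values in `T`. It is specified by the joint law of `(S_R, H)`. The noise
`Z` is `CN(0,1)` and independent of `(S_R, H)` and of the input. -/
structure FadingChannel (R T : Type*) [MeasurableSpace R] [MeasurableSpace T] where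
  law : Measure (R × ℂ)
  isProbabilityMeasure_law : IsProbabilityMeasure law
  secondMoment : ∫ w, ‖w.2‖ ^ 2 ∂law = 1
  csit : R → T
  measurable_csit : Measurable csit

/-- A block code of length `n` with `M` messages. The `i`-th channel input is a function of the
message and of the CSIT up to time `i` (causal CSIT). The decoder sees the channel outputs
and the CSIR of the whole block. -/
structure BlockCode (R T : Type*) [MeasurableSpace R] [MeasurableSpace T] (n M : ℕ) where
  encode : Fin M → (i : Fin n) → (Set.Iic i → T) → ℂ
  measurable_encode : ∀ m i, Measurable (encode m i)
  decode : (Fin n → ℂ × R) → Fin M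
  measurable_decode : Measurable decode

namespace FadingChannel

variable {R T : Type*} [MeasurableSpace R] [MeasurableSpace T]

attribute [instance] FadingChannel.isProbabilityMeasure_law

/-- The law of the CSIR `S_R`. -/
def lawR (c : FadingChannel R T) : Measure R := c.law.fst

instance (c : FadingChannel R T) : IsProbabilityMeasure c.lawR :=
  inferInstanceAs (IsProbabilityMeasure c.law.fst)

/-- The law of the CSIT `S_T`. -/
def lawT (c : FadingChannel R T) : Measure T := c.lawR.map c.csit

/-- The conditional mean `E[H | S_R = s]`. -/
def condMean (c : FadingChannel R T) (s : R) : ℂ := ∫ h, h ∂(c.law.condKernel s)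

/-- The channel gain `|E[H | S_R = s]|²`. -/
def gain (c : FadingChannel R T) (s : R) : ℝ := ‖c.condMean s‖ ^ 2

/-- The conditional variance `Var[H | S_R = s]`. -/
def variance (c : FadingChannel R T) (s : R) : ℝ :=
  ∫ h, ‖h - c.condMean s‖ ^ 2 ∂(c.law.condKernel s)

/-! ### Coding -/

/-- The i.i.d. triples `((S_R, H), Z)` of `n` channel uses. -/
def blockLaw (c : FadingChannel R T) (n : ℕ) : Measure (Fin n → (R × ℂ) × ℂ) :=
  Measure.pi fun _ => c.law.prod cscg

/-- The channel input at time `i` for the message `m`. -/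
def input (c : FadingChannel R T) {n M : ℕ} (C : BlockCode R T n M) (m : Fin M)
    (w : Fin n → (R × ℂ) × ℂ) (i : Fin n) : ℂ :=
  C.encode m i fun j => c.csit (w j).1.1

/-- What the receiver sees at time `i`: the pair `(H X + Z, S_R)`. -/
def output (c : FadingChannel R T) {n M : ℕ} (C : BlockCode R T n M) (m : Fin M)
    (w : Fin n → (R × ℂ) × ℂ) (i : Fin n) : ℂ × R :=
  ((w i).1.2 * c.input C m w i + (w i).2, (w i).1.1)

/-- The error probability for a uniformly distributed message. -/
def errorProb (c : FadingChannel R T) {n M : ℕ} (C : BlockCode R T n M) : ℝ :=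
  (∑ m, (c.blockLaw n).real {w | C.decode (c.output C m w) ≠ m}) / M

/-- The average block power `(1/n) ∑ E|X_i|²` for a uniformly distributed message. -/
def blockPower (c : FadingChannel R T) {n M : ℕ} (C : BlockCode R T n M) : ENNReal :=
  (∑ m, ∑ i, ∫⁻ w, ‖c.input C m w i‖ₑ ^ 2 ∂(c.blockLaw n)) / (n * M)

/-- The rate `r` (nats per channel use) is achievable under the average block power
constraint `P`. -/
def Achievable (c : FadingChannel R T) (P r : ℝ) : Prop :=
  ∀ ε > 0, ∀ᶠ n : ℕ in atTop, ∃ (M : ℕ) (C : BlockCode R T n M),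
    Real.exp (n * (r - ε)) ≤ M ∧ c.blockPower C ≤ ENNReal.ofReal P ∧ c.errorProb C ≤ ε

/-! ### Power policies -/

/-- A power policy: nonnegative powers `p (S_T)` with a finite mean. -/
structure IsPolicy (c : FadingChannel R T) (p : T → ℝ) : Prop where
  measurable : Measurable p
  nonneg : ∀ t, 0 ≤ p t
  integrable : Integrable p c.lawT

/-- `E[p (S_T)]`. -/
def meanPower (c : FadingChannel R T) (p : T → ℝ) : ℝ := ∫ t, p t ∂c.lawT

/-- The rate in nats of the channel uses with CSIR `s`. -/
def rateAt (c : FadingChannel R T) (p : T → ℝ) (s : R) : ℝ :=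
  Real.log (1 + c.gain s * p (c.csit s) / (1 + c.variance s * p (c.csit s)))

/-- The average of `rateAt` over the CSIR. -/
def rate (c : FadingChannel R T) (p : T → ℝ) : ℝ := ∫ s, c.rateAt p s ∂c.lawR

/-- `p` spends the power `P` and has the largest rate among all policies that satisfy the power
constraint `P`. -/
def IsOptimal (c : FadingChannel R T) (P : ℝ) (p : T → ℝ) : Prop :=
  c.IsPolicy p ∧ c.meanPower p = P ∧
    ∀ q, c.IsPolicy q → c.meanPower q ≤ P → c.rate q ≤ c.rate p

/-- The integral, with respect to the conditional law of `S_R` given `S_T = t`, of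
`g / ([1 + (g + σ²) Q] [1 + σ² Q])`. -/
def marginalRate [StandardBorelSpace R] [Nonempty R] (c : FadingChannel R T) (t : T) (Q : ℝ) : ℝ :=
  ∫ s, c.gain s / ((1 + (c.gain s + c.variance s) * Q) * (1 + c.variance s * Q))
    ∂(condDistrib id c.csit c.lawR t)

/-- `S_T` determines `S_R`. -/
def Determines (c : FadingChannel R T) : Prop :=
  ∃ g : T → R, Measurable g ∧ ∀ᵐ s ∂c.lawR, g (c.csit s) = s

/-! ### The forward model GMI -/

/-- The AWGN density `q(y | x) = exp (-|y - a x|² / v) / (π v)` of the auxiliary model. -/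
def auxDensity (a : ℂ) (v : ℝ) (x y : ℂ) : ℝ :=
  Real.exp (-‖y - a * x‖ ^ 2 / v) / (Real.pi * v)

/-- The output density `q(y)` of the auxiliary model for the `CN(0, Q)` input `√Q U`. -/
def auxOutput (Q : ℝ) (a : ℂ) (v : ℝ) (y : ℂ) : ℝ :=
  ∫ u, auxDensity a v (Real.sqrt Q * u) y ∂cscg

/-- The joint law of `((S_R, H), (U, Z))`, with `U` and `Z` independent `CN(0,1)`. -/
def jointLaw (c : FadingChannel R T) : Measure ((R × ℂ) × (ℂ × ℂ)) := c.law.prod (cscg.prod cscg)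

/-- `log (q(Y | X, S_R) / q(Y | S_R))` for `X = √(p (S_T)) U`, the true output `Y = H X + Z`
and the auxiliary model with parameters `a (S_R)` and `v (S_R)`. -/
def infoDensity (c : FadingChannel R T) (p : T → ℝ) (a : R → ℂ) (v : R → ℝ)
    (w : (R × ℂ) × (ℂ × ℂ)) : ℝ :=
  let s := w.1.1
  let Q := p (c.csit s)
  let x : ℂ := Real.sqrt Q * w.2.1
  let y : ℂ := w.1.2 * x + w.2.2
  Real.log (auxDensity (a s) (v s) x y / auxOutput Q (a s) (v s) y)

/-- All values of the GMI `I₁(X; Y | S_R) = E[log (q(Y | X, S_R) / q(Y | S_R))]` with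
`X ~ CN(0, p (s_T))` given `S_T = s_T` as the AWGN auxiliary model varies with its parameters
`a (s_R) ∈ ℂ` and `v (s_R) > 0`. -/
def forwardGMIs (c : FadingChannel R T) (p : T → ℝ) : Set ℝ :=
  {r | ∃ (a : R → ℂ) (v : R → ℝ), Measurable a ∧ Measurable v ∧ (∀ s, 0 < v s) ∧
    Integrable (c.infoDensity p a v) c.jointLaw ∧ r = ∫ w, c.infoDensity p a v w ∂c.jointLaw}

end FadingChannel

/-- The quadratic function `f(Q, g, σ²)` of the waterfilling rule. -/
def quadWater (Q g σ2 : ℝ) : ℝ := (1 + 2 * (σ2 / g)) * Q + (1 + σ2 / g) * σ2 * Q ^ 2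

end

open scoped ENNReal Topology

noncomputable section

/-! With a Gaussian input the output of an assumed model `(a, v)` is again Gaussian, so the
information density is a logarithm plus two quadratic terms. Its conditional mean given `S_R` then
depends on the law of `H` only through the conditional mean and variance. The inequality `log x ≤ x
- 1` and AM-GM bound it by the rate integrand (`gaussian_gmi_le`). Equality holds when `a` is the
conditional mean of `H` and `v` is one plus the conditional variance times the power.

Achievability uses an i.i.d. Gaussian codebook scaled by `√p(S_T)` and a threshold test on this same
information density. For every output, the exponential of the metric averages to one over an
independent codeword, whatever the true channel is (`integral_exp_letterMetric`). Markov's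
inequality therefore makes false alarms exponentially rare, and the law of large numbers handles the
true codeword. Power and error are controlled together by averaging one weighted sum over codebooks
(`exists_code`).

For the power allocation, the rate is concave in the power with a tangent gap that is strict when
the gain is positive. The Karush-Kuhn-Tucker conditions are therefore sufficient (`rate_sub_rate`).
Necessity needs no perturbation argument. For each `lam > 0` the policy `level` is stationary, its
mean power is continuous in `lam`, and some `lam` spends exactly `P`. A stationary policy with a
positive multiplier is the almost everywhere unique optimum (`IsStationary.ae_eq`), so every optimal
policy inherits its conditions. If the gain vanishes almost surely, every policy is stationary with
multiplier zero. When `S_T` determines `S_R`, the conditional mean is a point evaluation, and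
solving for the reciprocal of the slope gives the quadratic rule. -/

theorem measurable_cscg_density :
    Measurable fun z : ℂ => ENNReal.ofReal (Real.exp (-‖z‖ ^ 2) / Real.pi) := by
  fun_prop

theorem integral_cscg {E : Type*} [NormedAddCommGroup E] [NormedSpace ℝ E] (f : ℂ → E) :
    ∫ z, f z ∂cscg = ∫ z : ℂ, (Real.exp (-‖z‖ ^ 2) / Real.pi) • f z := by
  rw [cscg, integral_withDensity_eq_integral_toReal_smul measurable_cscg_density
    (ae_of_all _ fun _ => ENNReal.ofReal_lt_top)]
  refine integral_congr_ae (ae_of_all _ fun z => ?_)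
  simp only
  rw [ENNReal.toReal_ofReal (by positivity)]

theorem integral_exp_neg_mul_norm_sub_sq {b : ℝ} (hb : 0 < b) (c : ℂ) :
    ∫ z : ℂ, Real.exp (-b * ‖z - c‖ ^ 2) = Real.pi / b := by
  rw [integral_sub_right_eq_self (fun z : ℂ => Real.exp (-b * ‖z‖ ^ 2)) c,
    GaussianFourier.integral_rexp_neg_mul_sq_norm hb]
  simp

theorem integrable_exp_neg_norm_sq : Integrable fun z : ℂ => Real.exp (-‖z‖ ^ 2) := by
  -- The Bochner integral of a non-integrable function is zero by convention, so a nonzero value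
  -- certifies integrability.
  refine Integrable.of_integral_ne_zero ?_
  have := integral_exp_neg_mul_norm_sub_sq one_pos 0
  simp only [neg_mul, one_mul, sub_zero, div_one] at this
  rw [this]
  exact Real.pi_ne_zero

instance isProbabilityMeasure_cscg : IsProbabilityMeasure cscg := by
  constructor
  rw [cscg, withDensity_apply _ MeasurableSet.univ, Measure.restrict_univ,
    ← ofReal_integral_eq_lintegral_ofReal (integrable_exp_neg_norm_sq.div_const _)
      (ae_of_all _ fun z => by positivity), integral_div]
  have := integral_exp_neg_mul_norm_sub_sq one_pos 0
  simp only [neg_mul, one_mul, sub_zero, div_one] at this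
  rw [this, div_self Real.pi_ne_zero, ENNReal.ofReal_one]

theorem integral_norm_sq_cscg : ∫ z, ‖z‖ ^ 2 ∂cscg = 1 := by
  rw [integral_cscg]
  -- Polar coordinates reduce the second moment to `Γ(2) = 1`.
  have h := Complex.integral_rpow_mul_exp_neg_rpow (p := 2) (q := 2) (by norm_num) (by norm_num)
  have h2 : ((2 : ℝ) + 2) / 2 = 1 + 1 := by norm_num
  rw [h2, Real.Gamma_add_one one_ne_zero, Real.Gamma_one] at h
  simp only [Real.rpow_two] at h
  have : ∀ z : ℂ, (Real.exp (-‖z‖ ^ 2) / Real.pi) • ‖z‖ ^ 2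
      = Real.pi⁻¹ * (‖z‖ ^ 2 * Real.exp (-‖z‖ ^ 2)) := fun z => by
    rw [smul_eq_mul]; ring
  simp_rw [this]
  rw [integral_const_mul, h]
  field_simp

theorem integrable_norm_sq_cscg : Integrable (fun z : ℂ => ‖z‖ ^ 2) cscg :=
  Integrable.of_integral_ne_zero (by rw [integral_norm_sq_cscg]; exact one_ne_zero)

theorem integrable_of_sq_norm {α : Type*} [MeasurableSpace α] {μ : Measure α} [IsFiniteMeasure μ]
    {f : α → ℂ} (hf : AEStronglyMeasurable f μ) (h : Integrable (fun x => ‖f x‖ ^ 2) μ) :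
    Integrable f μ := by
  refine ((integrable_const (1 : ℝ)).add h).mono' hf (ae_of_all _ fun x => ?_)
  simp only [Pi.add_apply]
  nlinarith [sq_nonneg (‖f x‖ - 1), norm_nonneg (f x)]

theorem integrable_id_cscg : Integrable (fun z : ℂ => z) cscg :=
  integrable_of_sq_norm (by fun_prop) integrable_norm_sq_cscg

theorem integral_id_cscg : ∫ z, z ∂cscg = 0 := by
  rw [integral_cscg]
  have h := integral_neg_eq_self (μ := volume)
    (fun z : ℂ => (Real.exp (-‖z‖ ^ 2) / Real.pi) • z)
  simp only [norm_neg, smul_neg, integral_neg] at h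
  exact self_eq_neg.mp h.symm

theorem norm_add_sq_complex (x y : ℂ) :
    ‖x + y‖ ^ 2 = ‖x‖ ^ 2 + ‖y‖ ^ 2 + 2 * (x * (starRingEnd ℂ) y).re := by
  rw [Complex.sq_norm, Complex.sq_norm, Complex.sq_norm, Complex.normSq_add]

theorem integrable_norm_mul_add_sq (b : ℂ) :
    Integrable (fun w : ℂ × ℂ => ‖b * w.1 + w.2‖ ^ 2) (cscg.prod cscg) := by
  have h1 : Integrable (fun w : ℂ × ℂ => ‖w.1‖ ^ 2) (cscg.prod cscg) :=
    integrable_norm_sq_cscg.comp_fst cscg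
  have h2 : Integrable (fun w : ℂ × ℂ => ‖w.2‖ ^ 2) (cscg.prod cscg) :=
    integrable_norm_sq_cscg.comp_snd cscg
  refine ((h1.const_mul (2 * ‖b‖ ^ 2)).add (h2.const_mul 2)).mono' (by fun_prop)
    (ae_of_all _ fun w => ?_)
  simp only [Pi.add_apply]
  rw [Real.norm_of_nonneg (by positivity)]
  have := norm_add_le (b * w.1) w.2
  rw [norm_mul] at this
  nlinarith [sq_nonneg (‖b‖ * ‖w.1‖ - ‖w.2‖), norm_nonneg (b * w.1 + w.2)]

theorem integral_norm_mul_add_sq (b : ℂ) :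
    ∫ w, ‖b * w.1 + w.2‖ ^ 2 ∂(cscg.prod cscg) = ‖b‖ ^ 2 + 1 := by
  have h1 : Integrable (fun w : ℂ × ℂ => ‖b‖ ^ 2 * ‖w.1‖ ^ 2) (cscg.prod cscg) :=
    (integrable_norm_sq_cscg.comp_fst cscg).const_mul _
  have h2 : Integrable (fun w : ℂ × ℂ => ‖w.2‖ ^ 2) (cscg.prod cscg) :=
    integrable_norm_sq_cscg.comp_snd cscg
  have hc : Integrable (fun z : ℂ => (starRingEnd ℂ) z) cscg :=
    integrable_of_sq_norm (by fun_prop) (by simpa using integrable_norm_sq_cscg)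
  have h3 : Integrable (fun w : ℂ × ℂ => (b * w.1) * (starRingEnd ℂ) w.2) (cscg.prod cscg) :=
    (integrable_id_cscg.const_mul b).mul_prod hc
  have h3' : Integrable (fun w : ℂ × ℂ => ((b * w.1) * (starRingEnd ℂ) w.2).re)
      (cscg.prod cscg) := h3.re
  have h4 : ∫ w : ℂ × ℂ, ((b * w.1) * (starRingEnd ℂ) w.2).re ∂(cscg.prod cscg) = 0 := by
    have := integral_re h3
    simp only [RCLike.re_eq_complex_re] at this
    rw [this, integral_prod_mul (fun z : ℂ => b * z) (fun z : ℂ => (starRingEnd ℂ) z),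
      integral_const_mul, integral_id_cscg]
    simp
  simp_rw [norm_add_sq_complex, norm_mul, mul_pow]
  have h12 : Integrable (fun w : ℂ × ℂ => ‖b‖ ^ 2 * ‖w.1‖ ^ 2 + ‖w.2‖ ^ 2) (cscg.prod cscg) :=
    h1.add h2
  rw [integral_add h12 (h3'.const_mul 2), integral_add h1 h2, integral_const_mul,
    integral_const_mul, h4]
  have e1 : ∫ w : ℂ × ℂ, ‖w.1‖ ^ 2 ∂(cscg.prod cscg) = 1 := by
    rw [integral_fun_fst (fun z : ℂ => ‖z‖ ^ 2), integral_norm_sq_cscg]; simp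
  have e2 : ∫ w : ℂ × ℂ, ‖w.2‖ ^ 2 ∂(cscg.prod cscg) = 1 := by
    rw [integral_fun_snd (fun z : ℂ => ‖z‖ ^ 2), integral_norm_sq_cscg]; simp
  rw [e1, e2]; ring

/-! ### The auxiliary Gaussian model in closed form -/

namespace FadingChannel

/-- Completing the square in `u` splits the joint exponent of input and output into the output
exponent and the exponent of the input given the output, so that `u` can be integrated out. -/
theorem complete_square {v : ℝ} (hv : 0 < v) (b y u : ℂ) :
    ‖y - b * u‖ ^ 2 / v + ‖u‖ ^ 2 = ‖y‖ ^ 2 / (v + ‖b‖ ^ 2)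
      + (v + ‖b‖ ^ 2) / v * ‖u - (starRingEnd ℂ) b * y / ((v + ‖b‖ ^ 2 : ℝ) : ℂ)‖ ^ 2 := by
  have hW : 0 < v + ‖b‖ ^ 2 := by positivity
  obtain ⟨W, hWd⟩ : ∃ W, W = v + ‖b‖ ^ 2 := ⟨_, rfl⟩
  rw [← hWd] at hW ⊢
  have hb : ‖b‖ ^ 2 = W - v := by linarith
  simp only [Complex.sq_norm] at hb ⊢
  rw [Complex.normSq_sub u, Complex.normSq_div, Complex.normSq_mul, Complex.normSq_conj, hb,
    Complex.normSq_sub y, Complex.normSq_mul, hb, Complex.normSq_ofReal]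
  have e : (u * (starRingEnd ℂ) ((starRingEnd ℂ) b * y / (W : ℂ))).re
      = (y * (starRingEnd ℂ) (b * u)).re / W := by
    simp only [map_div₀, map_mul, Complex.conj_conj, Complex.conj_ofReal]
    rw [← mul_div_assoc, Complex.div_ofReal_re]
    congr 1
    simp
    ring
  rw [e]
  field_simp
  ring

theorem auxOutput_eq {Q v : ℝ} (hQ : 0 ≤ Q) (hv : 0 < v) (a y : ℂ) :
    auxOutput Q a v y
      = Real.exp (-‖y‖ ^ 2 / (v + ‖a‖ ^ 2 * Q)) / (Real.pi * (v + ‖a‖ ^ 2 * Q)) := by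
  have hb : ‖a * (Real.sqrt Q : ℂ)‖ ^ 2 = ‖a‖ ^ 2 * Q := by
    rw [norm_mul, mul_pow, Complex.norm_real, Real.norm_eq_abs, sq_abs, Real.sq_sqrt hQ]
  have hW : 0 < v + ‖a‖ ^ 2 * Q := by positivity
  unfold auxOutput
  rw [integral_cscg]
  have key : ∀ u : ℂ, (Real.exp (-‖u‖ ^ 2) / Real.pi) • auxDensity a v (Real.sqrt Q * u) y
      = Real.exp (-‖y‖ ^ 2 / (v + ‖a‖ ^ 2 * Q)) / (Real.pi * (Real.pi * v)) *
        Real.exp (-((v + ‖a‖ ^ 2 * Q) / v) * ‖u - (starRingEnd ℂ) (a * (Real.sqrt Q : ℂ)) * y /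
          ((v + ‖a‖ ^ 2 * Q : ℝ) : ℂ)‖ ^ 2) := fun u => by
    have h := complete_square hv (a * (Real.sqrt Q : ℂ)) y u
    rw [hb] at h
    rw [auxDensity, smul_eq_mul, div_mul_div_comm, ← Real.exp_add, div_mul_eq_mul_div,
      ← Real.exp_add, ← mul_assoc a]
    congr 2
    linear_combination -h
  simp_rw [key]
  rw [integral_const_mul, integral_exp_neg_mul_norm_sub_sq (by positivity)]
  field_simp

theorem log_auxDensity_div_auxOutput {Q v : ℝ} (hQ : 0 ≤ Q) (hv : 0 < v) (a x y : ℂ) :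
    Real.log (auxDensity a v x y / auxOutput Q a v y)
      = Real.log ((v + ‖a‖ ^ 2 * Q) / v) - ‖y - a * x‖ ^ 2 / v
        + ‖y‖ ^ 2 / (v + ‖a‖ ^ 2 * Q) := by
  have hW : 0 < v + ‖a‖ ^ 2 * Q := by positivity
  rw [auxOutput_eq hQ hv, auxDensity, Real.log_div (by positivity) (by positivity),
    Real.log_div (by positivity) (by positivity), Real.log_div (by positivity) (by positivity),
    Real.log_div hW.ne' hv.ne', Real.log_exp, Real.log_exp,
    Real.log_mul Real.pi_ne_zero hv.ne', Real.log_mul Real.pi_ne_zero hW.ne']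
  ring

end FadingChannel

/-- The Gaussian mutual information bounds the forward model GMI: `m, a` are the moduli of the true
and the assumed gain, `d` bounds the squared distance of the gains, `N` is the true noise power. -/
theorem gaussian_gmi_le {m a d N v Q : ℝ} (hd : (m - a) ^ 2 ≤ d)
    (hN : 0 < N) (hv : 0 < v) (hQ : 0 ≤ Q) :
    Real.log ((v + a ^ 2 * Q) / v) - (N + d * Q) / v + (N + m ^ 2 * Q) / (v + a ^ 2 * Q)
      ≤ Real.log (1 + m ^ 2 * Q / N) := by
  obtain ⟨W, hW⟩ : ∃ W, W = v + a ^ 2 * Q := ⟨_, rfl⟩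
  obtain ⟨D, hD⟩ : ∃ D, D = N + m ^ 2 * Q := ⟨_, rfl⟩
  have hW0 : 0 < W := by rw [hW]; positivity
  have hD0 : 0 < D := by rw [hD]; positivity
  rw [← hW, ← hD]
  have e1 : 1 + m ^ 2 * Q / N = D / N := by rw [hD]; field_simp
  -- The argument is the assumed ratio of output to noise power over the true one; it equals one for
  -- the matched model.
  have h1 := Real.log_le_sub_one_of_pos (x := W * N / (v * D)) (by positivity)
  have e2 : Real.log (W * N / (v * D)) = Real.log (W / v) - Real.log (D / N) := by
    rw [← Real.log_div (by positivity) (by positivity)]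
    congr 1
    field_simp
  rw [e1]
  suffices h : W * N / (v * D) - 1 ≤ (N + d * Q) / v - D / W by linarith
  have amgm : 2 * (m * a) ≤ W * m ^ 2 / D + D * a ^ 2 / W := by
    rw [div_add_div _ _ hD0.ne' hW0.ne', le_div_iff₀ (by positivity)]
    nlinarith [sq_nonneg (W * m - D * a)]
  -- What remains is the AM-GM defect plus the defect of `hd`, both weighted by `Q / v`.
  have e3 : (N + d * Q) / v - D / W - (W * N / (v * D) - 1)
      = (Q * (W * m ^ 2 / D + D * a ^ 2 / W - 2 * (m * a)) + (d - (m - a) ^ 2) * Q) / v := by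
    have hv' : v = W - a ^ 2 * Q := by linarith
    have hN' : N = D - m ^ 2 * Q := by linarith
    field_simp
    rw [hN', hv']
    ring
  have h3 : 0 ≤ (Q * (W * m ^ 2 / D + D * a ^ 2 / W - 2 * (m * a)) + (d - (m - a) ^ 2) * Q) / v := by
    have := sub_nonneg.2 amgm
    have := sub_nonneg.2 hd
    positivity
  linarith

/-! ### Conditional moments of the fading and integrability of the rate -/

namespace FadingChannel

variable {R T : Type*} [MeasurableSpace R] [MeasurableSpace T] (c : FadingChannel R T)

@[fun_prop]
theorem measurable_condMean : Measurable c.condMean := by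
  have : StronglyMeasurable fun s => ∫ h, h ∂(c.law.condKernel s) :=
    StronglyMeasurable.integral_kernel_prod_right' (κ := c.law.condKernel)
      (f := fun x : R × ℂ => x.2) measurable_snd.stronglyMeasurable
  exact this.measurable

@[fun_prop]
theorem measurable_gain : Measurable c.gain := by
  unfold gain
  fun_prop

@[fun_prop]
theorem measurable_variance : Measurable c.variance := by
  have : StronglyMeasurable fun s => ∫ h, ‖h - c.condMean s‖ ^ 2 ∂(c.law.condKernel s) :=
    StronglyMeasurable.integral_kernel_prod_right' (κ := c.law.condKernel)
      (f := fun x : R × ℂ => ‖x.2 - c.condMean x.1‖ ^ 2)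
      (Measurable.stronglyMeasurable (by fun_prop))
  exact this.measurable

theorem gain_nonneg (s : R) : 0 ≤ c.gain s := by unfold gain; positivity

theorem variance_nonneg (s : R) : 0 ≤ c.variance s := integral_nonneg fun _ => by positivity

/-- The normalization of the second moment to one already contains its finiteness, since otherwise
the Bochner integral would be zero. -/
theorem integrable_norm_sq_snd : Integrable (fun w : R × ℂ => ‖w.2‖ ^ 2) c.law :=
  Integrable.of_integral_ne_zero (by rw [c.secondMoment]; exact one_ne_zero)

theorem ae_integrable_norm_sq :
    ∀ᵐ s ∂c.lawR, Integrable (fun h : ℂ => ‖h‖ ^ 2) (c.law.condKernel s) :=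
  c.integrable_norm_sq_snd.condKernel_ae

theorem integrable_norm_sub_sq {μ : Measure ℂ} [IsFiniteMeasure μ]
    (hμ : Integrable (fun h : ℂ => ‖h‖ ^ 2) μ) (a : ℂ) :
    Integrable (fun h : ℂ => ‖h - a‖ ^ 2) μ := by
  refine ((hμ.const_mul 2).add (integrable_const (2 * ‖a‖ ^ 2))).mono' (by fun_prop)
    (ae_of_all _ fun h => ?_)
  rw [Real.norm_of_nonneg (by positivity)]
  simp only [Pi.add_apply]
  have := norm_sub_le h a
  nlinarith [sq_nonneg (‖h‖ - ‖a‖), norm_nonneg (h - a)]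

/-- Bias-variance decomposition. -/
theorem integral_norm_sub_sq {s : R}
    (hs : Integrable (fun h : ℂ => ‖h‖ ^ 2) (c.law.condKernel s)) (a : ℂ) :
    ∫ h, ‖h - a‖ ^ 2 ∂(c.law.condKernel s) = c.variance s + ‖c.condMean s - a‖ ^ 2 := by
  set m := c.condMean s with hm
  have h1 : Integrable (fun h : ℂ => h) (c.law.condKernel s) :=
    integrable_of_sq_norm (by fun_prop) hs
  have h2 : Integrable (fun h : ℂ => ‖h - m‖ ^ 2) (c.law.condKernel s) :=
    integrable_norm_sub_sq hs m
  have h3 : Integrable (fun h : ℂ => (h - m) * (starRingEnd ℂ) (m - a)) (c.law.condKernel s) :=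
    (h1.sub (integrable_const m)).mul_const _
  have h3' : Integrable (fun h : ℂ => ((h - m) * (starRingEnd ℂ) (m - a)).re)
    (c.law.condKernel s) := h3.re
  have h4 : ∫ h, ((h - m) * (starRingEnd ℂ) (m - a)).re ∂(c.law.condKernel s) = 0 := by
    have := integral_re h3
    simp only [RCLike.re_eq_complex_re] at this
    rw [this, integral_mul_const, integral_sub h1 (integrable_const m)]
    have e : ∫ h, h ∂(c.law.condKernel s) = m := rfl
    simp [e]
  have h5 : ∀ h : ℂ, ‖h - a‖ ^ 2 = ‖h - m‖ ^ 2 + ‖m - a‖ ^ 2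
      + 2 * ((h - m) * (starRingEnd ℂ) (m - a)).re := fun h => by
    rw [← norm_add_sq_complex, sub_add_sub_cancel]
  have h6 : Integrable (fun h : ℂ => ‖h - m‖ ^ 2 + ‖m - a‖ ^ 2) (c.law.condKernel s) :=
    h2.add (integrable_const _)
  rw [integral_congr_ae (ae_of_all _ h5)]
  rw [integral_add h6 (h3'.const_mul 2), integral_add h2 (integrable_const _),
    integral_const_mul, h4]
  simp [variance, ← hm]

theorem integral_norm_sq_condKernel {s : R}
    (hs : Integrable (fun h : ℂ => ‖h‖ ^ 2) (c.law.condKernel s)) :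
    ∫ h, ‖h‖ ^ 2 ∂(c.law.condKernel s) = c.variance s + c.gain s := by
  have := c.integral_norm_sub_sq hs 0
  simpa [gain] using this

theorem integrable_variance_add_gain :
    Integrable (fun s => c.variance s + c.gain s) c.lawR := by
  have h := c.integrable_norm_sq_snd.integral_condKernel
  refine h.congr ?_
  filter_upwards [c.ae_integrable_norm_sq] with s hs
  exact c.integral_norm_sq_condKernel hs

theorem integrable_gain : Integrable c.gain c.lawR := by
  refine c.integrable_variance_add_gain.mono' (by fun_prop) (ae_of_all _ fun s => ?_)
  rw [Real.norm_of_nonneg (c.gain_nonneg s)]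
  linarith [c.variance_nonneg s]

variable {c} {p : T → ℝ}

theorem IsPolicy.integrable_comp (hp : c.IsPolicy p) : Integrable (fun s => p (c.csit s)) c.lawR :=
  hp.integrable.comp_measurable c.measurable_csit

theorem IsPolicy.meanPower_eq (hp : c.IsPolicy p) :
    c.meanPower p = ∫ s, p (c.csit s) ∂c.lawR := by
  rw [meanPower, lawT, integral_map c.measurable_csit.aemeasurable
    hp.measurable.aestronglyMeasurable]

theorem IsPolicy.measurable_rateAt (hp : c.IsPolicy p) : Measurable (c.rateAt p) := by
  have hp1 := hp.measurable
  have hp2 := c.measurable_csit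
  unfold rateAt
  fun_prop

theorem rateAt_nonneg (hp : ∀ t, 0 ≤ p t) (s : R) : 0 ≤ c.rateAt p s := by
  have h1 := c.gain_nonneg s
  have h2 := c.variance_nonneg s
  have h3 := hp (c.csit s)
  exact Real.log_nonneg (le_add_of_nonneg_right (by positivity))

/-- Bounding `1 + gQ` by `(1 + g)(1 + Q)` separates gain and power. Each is integrable, while their
product need not be. -/
theorem rateAt_le (hp : ∀ t, 0 ≤ p t) (s : R) : c.rateAt p s ≤ c.gain s + p (c.csit s) := by
  have h1 := c.gain_nonneg s
  have h2 := c.variance_nonneg s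
  have h3 := hp (c.csit s)
  have h4 : c.gain s * p (c.csit s) / (1 + c.variance s * p (c.csit s))
      ≤ c.gain s * p (c.csit s) :=
    div_le_self (by positivity) (le_add_of_nonneg_right (by positivity))
  have h5 : Real.log ((1 + c.gain s) * (1 + p (c.csit s))) ≤ c.gain s + p (c.csit s) := by
    rw [Real.log_mul (by positivity) (by positivity)]
    have := Real.log_le_sub_one_of_pos (x := 1 + c.gain s) (by positivity)
    have := Real.log_le_sub_one_of_pos (x := 1 + p (c.csit s)) (by positivity)
    linarith
  refine le_trans (Real.log_le_log (by positivity) ?_) h5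
  nlinarith

theorem IsPolicy.integrable_rateAt (hp : c.IsPolicy p) : Integrable (c.rateAt p) c.lawR := by
  refine (c.integrable_gain.add hp.integrable_comp).mono'
    hp.measurable_rateAt.aestronglyMeasurable (ae_of_all _ fun s => ?_)
  rw [Real.norm_of_nonneg (rateAt_nonneg hp.nonneg s)]
  exact rateAt_le hp.nonneg s

theorem rate_nonneg (hp : ∀ t, 0 ≤ p t) : 0 ≤ c.rate p :=
  integral_nonneg fun s => rateAt_nonneg hp s

/-! ### The GMI as a function of the auxiliary model -/

theorem infoDensity_eq (hp : ∀ t, 0 ≤ p t) {a : R → ℂ} {v : R → ℝ} (hv : ∀ s, 0 < v s)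
    (w : (R × ℂ) × (ℂ × ℂ)) :
    c.infoDensity p a v w
      = Real.log ((v w.1.1 + ‖a w.1.1‖ ^ 2 * p (c.csit w.1.1)) / v w.1.1)
        - ‖(w.1.2 - a w.1.1) * (Real.sqrt (p (c.csit w.1.1)) : ℂ) * w.2.1 + w.2.2‖ ^ 2 / v w.1.1
        + ‖w.1.2 * (Real.sqrt (p (c.csit w.1.1)) : ℂ) * w.2.1 + w.2.2‖ ^ 2
          / (v w.1.1 + ‖a w.1.1‖ ^ 2 * p (c.csit w.1.1)) := by
  simp only [infoDensity]
  rw [log_auxDensity_div_auxOutput (hp _) (hv _)]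
  congr 5 <;> ring

theorem norm_mul_sqrt_sq {Q : ℝ} (hQ : 0 ≤ Q) (b : ℂ) :
    ‖b * (Real.sqrt Q : ℂ)‖ ^ 2 = ‖b‖ ^ 2 * Q := by
  rw [norm_mul, mul_pow, Complex.norm_real, Real.norm_eq_abs, sq_abs, Real.sq_sqrt hQ]

/-- The conditional mean of `infoDensity` given `(S_R, H)`. -/
theorem integral_infoDensity_inner (hp : ∀ t, 0 ≤ p t) {a : R → ℂ} {v : R → ℝ}
    (hv : ∀ s, 0 < v s) (x : R × ℂ) :
    ∫ y, c.infoDensity p a v (x, y) ∂(cscg.prod cscg)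
      = Real.log ((v x.1 + ‖a x.1‖ ^ 2 * p (c.csit x.1)) / v x.1)
        - (‖x.2 - a x.1‖ ^ 2 * p (c.csit x.1) + 1) / v x.1
        + (‖x.2‖ ^ 2 * p (c.csit x.1) + 1) / (v x.1 + ‖a x.1‖ ^ 2 * p (c.csit x.1)) := by
  simp_rw [infoDensity_eq hp hv]
  have h1 := (integrable_norm_mul_add_sq
    ((x.2 - a x.1) * (Real.sqrt (p (c.csit x.1)) : ℂ))).div_const (v x.1)
  have h2 := (integrable_norm_mul_add_sq (x.2 * (Real.sqrt (p (c.csit x.1)) : ℂ))).div_const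
    (v x.1 + ‖a x.1‖ ^ 2 * p (c.csit x.1))
  have h3 := (integrable_const (μ := cscg.prod cscg)
    (Real.log ((v x.1 + ‖a x.1‖ ^ 2 * p (c.csit x.1)) / v x.1))).sub h1
  have e := integral_add h3 h2
  simp only [Pi.sub_apply] at e
  rw [e, integral_sub (integrable_const _) h1, integral_div, integral_div,
    integral_norm_mul_add_sq, integral_norm_mul_add_sq, norm_mul_sqrt_sq (hp _),
    norm_mul_sqrt_sq (hp _)]
  simp

/-- The conditional mean of `infoDensity` given `S_R`. -/
theorem integral_infoDensity_cond (hp : ∀ t, 0 ≤ p t) {a : R → ℂ} {v : R → ℝ}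
    (hv : ∀ s, 0 < v s) {s : R}
    (hs : Integrable (fun h : ℂ => ‖h‖ ^ 2) (c.law.condKernel s)) :
    ∫ h, ∫ y, c.infoDensity p a v ((s, h), y) ∂(cscg.prod cscg) ∂(c.law.condKernel s)
      = Real.log ((v s + ‖a s‖ ^ 2 * p (c.csit s)) / v s)
        - ((1 + c.variance s * p (c.csit s)) + ‖c.condMean s - a s‖ ^ 2 * p (c.csit s)) / v s
        + ((1 + c.variance s * p (c.csit s)) + ‖c.condMean s‖ ^ 2 * p (c.csit s))
          / (v s + ‖a s‖ ^ 2 * p (c.csit s)) := by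
  simp_rw [integral_infoDensity_inner hp hv]
  have h1 : Integrable (fun h => (‖h - a s‖ ^ 2 * p (c.csit s) + 1) / v s)
      (c.law.condKernel s) :=
    (((integrable_norm_sub_sq hs (a s)).mul_const _).add (integrable_const 1)).div_const _
  have h2 : Integrable (fun h => (‖h‖ ^ 2 * p (c.csit s) + 1)
      / (v s + ‖a s‖ ^ 2 * p (c.csit s))) (c.law.condKernel s) :=
    ((hs.mul_const _).add (integrable_const 1)).div_const _
  have h3 := (integrable_const (μ := c.law.condKernel s)
    (Real.log ((v s + ‖a s‖ ^ 2 * p (c.csit s)) / v s))).sub h1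
  have e := integral_add h3 h2
  simp only [Pi.sub_apply] at e
  rw [e, integral_sub (integrable_const _) h1, integral_div, integral_div,
    integral_add ((integrable_norm_sub_sq hs (a s)).mul_const _) (integrable_const 1),
    integral_add (hs.mul_const _) (integrable_const 1), integral_mul_const, integral_mul_const,
    c.integral_norm_sub_sq hs, c.integral_norm_sq_condKernel hs]
  simp only [integral_const, probReal_univ, smul_eq_mul, one_mul, gain]
  ring

theorem integral_infoDensity_eq {a : R → ℂ} {v : R → ℝ}
    (hi : Integrable (c.infoDensity p a v) c.jointLaw) :
    Integrable (fun s => ∫ h, ∫ y, c.infoDensity p a v ((s, h), y) ∂(cscg.prod cscg)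
      ∂(c.law.condKernel s)) c.lawR ∧
    ∫ w, c.infoDensity p a v w ∂c.jointLaw
      = ∫ s, ∫ h, ∫ y, c.infoDensity p a v ((s, h), y) ∂(cscg.prod cscg)
        ∂(c.law.condKernel s) ∂c.lawR := by
  have h1 := Integrable.integral_prod_left hi
  refine ⟨h1.integral_condKernel, ?_⟩
  rw [jointLaw, integral_prod _ hi]
  exact (Measure.integral_condKernel h1).symm

/-- The bound holds for each value of `S_R` separately. Phases do not matter: the reverse triangle
inequality passes from the gains to their moduli. -/
theorem IsPolicy.gmi_le_rate (hp : c.IsPolicy p) {a : R → ℂ} {v : R → ℝ} (hv : ∀ s, 0 < v s)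
    (hi : Integrable (c.infoDensity p a v) c.jointLaw) :
    ∫ w, c.infoDensity p a v w ∂c.jointLaw ≤ c.rate p := by
  obtain ⟨h1, h2⟩ := integral_infoDensity_eq hi
  rw [h2]
  refine integral_mono_ae h1 hp.integrable_rateAt ?_
  filter_upwards [c.ae_integrable_norm_sq] with s hs
  rw [integral_infoDensity_cond hp.nonneg hv hs]
  have hN := mul_nonneg (c.variance_nonneg s) (hp.nonneg (c.csit s))
  refine gaussian_gmi_le ?_ (by positivity) (hv s) (hp.nonneg _)
  rw [← sq_abs]
  gcongr
  exact abs_norm_sub_norm_le _ _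

/-- The square is divided by its own conditional power `W`, so its conditional mean given `S_R` is
exactly one. This is what gives integrability: the product of `|H|²` and the power need not have a
finite mean. -/
theorem IsPolicy.integrable_sq_div (hp : c.IsPolicy p) {b : R × ℂ → ℂ} (hb : Measurable b)
    {W : R → ℝ} (hW : Measurable W) (hW0 : ∀ s, 0 < W s) (hb2 : ∀ᵐ s ∂c.lawR,
      Integrable (fun h => ‖b (s, h)‖ ^ 2) (c.law.condKernel s) ∧
      (∫ h, ‖b (s, h)‖ ^ 2 ∂(c.law.condKernel s)) * p (c.csit s) + 1 = W s) :
    Integrable (fun w : (R × ℂ) × (ℂ × ℂ) =>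
      ‖b w.1 * (Real.sqrt (p (c.csit w.1.1)) : ℂ) * w.2.1 + w.2.2‖ ^ 2 / W w.1.1) c.jointLaw := by
  have hp1 := hp.measurable
  have hp2 := c.measurable_csit
  have m1 : Measurable (fun w : (R × ℂ) × (ℂ × ℂ) =>
      ‖b w.1 * (Real.sqrt (p (c.csit w.1.1)) : ℂ) * w.2.1 + w.2.2‖ ^ 2 / W w.1.1) := by fun_prop
  have m2 : Measurable (fun x : R × ℂ => (‖b x‖ ^ 2 * p (c.csit x.1) + 1) / W x.1) := by fun_prop
  have hpos : ∀ x : R × ℂ, 0 ≤ (‖b x‖ ^ 2 * p (c.csit x.1) + 1) / W x.1 := fun x =>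
    div_nonneg (add_nonneg (mul_nonneg (by positivity) (hp.nonneg _)) zero_le_one) (hW0 _).le
  have key : Integrable (fun x : R × ℂ => (‖b x‖ ^ 2 * p (c.csit x.1) + 1) / W x.1) c.law := by
    refine (AEStronglyMeasurable.ae_integrable_condKernel_iff m2.aestronglyMeasurable).1 ⟨?_, ?_⟩
    · filter_upwards [hb2] with s hs
      exact ((hs.1.mul_const _).add (integrable_const 1)).div_const _
    · refine (integrable_const (1 : ℝ)).congr ?_
      filter_upwards [hb2] with s hs
      rw [integral_congr_ae (ae_of_all _ fun h => Real.norm_of_nonneg (hpos (s, h)))]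
      dsimp only
      rw [integral_div, integral_add (hs.1.mul_const _) (integrable_const 1), integral_mul_const]
      simp only [integral_const, probReal_univ, smul_eq_mul, one_mul]
      rw [hs.2, div_self (hW0 s).ne']
  have h1 : ∀ x : R × ℂ, Integrable (fun y : ℂ × ℂ =>
      ‖b x * (Real.sqrt (p (c.csit x.1)) : ℂ) * y.1 + y.2‖ ^ 2 / W x.1) (cscg.prod cscg) :=
    fun x => (integrable_norm_mul_add_sq _).div_const _
  have h2 : ∀ x : R × ℂ, ∫ y : ℂ × ℂ, ‖‖b x * (Real.sqrt (p (c.csit x.1)) : ℂ) * y.1 + y.2‖ ^ 2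
      / W x.1‖ ∂(cscg.prod cscg) = (‖b x‖ ^ 2 * p (c.csit x.1) + 1) / W x.1 := fun x => by
    rw [integral_congr_ae (ae_of_all _ fun y => Real.norm_of_nonneg
      (div_nonneg (sq_nonneg _) (hW0 x.1).le))]
    rw [integral_div, integral_norm_mul_add_sq, norm_mul_sqrt_sq (hp.nonneg _)]
  exact (integrable_prod_iff m1.aestronglyMeasurable).2
    ⟨ae_of_all _ h1, key.congr (ae_of_all _ fun x => (h2 x).symm)⟩

theorem IsPolicy.noise_pos (hp : c.IsPolicy p) (s : R) : 0 < 1 + c.variance s * p (c.csit s) := by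
  have := mul_nonneg (c.variance_nonneg s) (hp.nonneg (c.csit s))
  positivity

theorem IsPolicy.log_ratio_eq_rateAt (hp : c.IsPolicy p) (s : R) :
    Real.log ((1 + c.variance s * p (c.csit s) + ‖c.condMean s‖ ^ 2 * p (c.csit s))
      / (1 + c.variance s * p (c.csit s))) = c.rateAt p s := by
  have := hp.noise_pos s
  rw [rateAt, gain]
  congr 1
  field_simp

/-- The optimal auxiliary model has the parameters `E[H|S_R]` and `1 + Var[H|S_R] p(S_T)`. -/
theorem IsPolicy.integrable_infoDensity (hp : c.IsPolicy p) :
    Integrable (c.infoDensity p c.condMean fun s => 1 + c.variance s * p (c.csit s))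
      c.jointLaw := by
  have hp1 := hp.measurable
  have hp2 := c.measurable_csit
  rw [funext (infoDensity_eq hp.nonneg hp.noise_pos)]
  have m0 : AEStronglyMeasurable (c.rateAt p) c.lawR := hp.measurable_rateAt.aestronglyMeasurable
  have h0 : Integrable (fun w : (R × ℂ) × (ℂ × ℂ) => c.rateAt p w.1.1) c.jointLaw :=
    Integrable.comp_fst (hp.integrable_rateAt.comp_measurable (μ := c.law) measurable_fst) _
  simp_rw [hp.log_ratio_eq_rateAt]
  refine (h0.sub (hp.integrable_sq_div (b := fun x => x.2 - c.condMean x.1) (by fun_prop)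
    (by fun_prop) hp.noise_pos ?_)).add
    (hp.integrable_sq_div (b := fun x => x.2)
      (W := fun s => 1 + c.variance s * p (c.csit s) + ‖c.condMean s‖ ^ 2 * p (c.csit s))
      (by fun_prop) (by fun_prop) (fun s => ?_) ?_)
  · filter_upwards [c.ae_integrable_norm_sq] with s hs
    refine ⟨integrable_norm_sub_sq hs _, ?_⟩
    rw [c.integral_norm_sub_sq hs]
    simp [add_comm]
  · have := hp.noise_pos s
    have := hp.nonneg (c.csit s)
    positivity
  · filter_upwards [c.ae_integrable_norm_sq] with s hs
    refine ⟨hs, ?_⟩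
    rw [c.integral_norm_sq_condKernel hs, gain]
    ring

/-- For the matched model both quadratic terms have conditional mean one and cancel, leaving the
logarithm. -/
theorem IsPolicy.integral_infoDensity (hp : c.IsPolicy p) :
    ∫ w, c.infoDensity p c.condMean (fun s => 1 + c.variance s * p (c.csit s)) w ∂c.jointLaw
      = c.rate p := by
  rw [(integral_infoDensity_eq hp.integrable_infoDensity).2, rate]
  refine integral_congr_ae ?_
  filter_upwards [c.ae_integrable_norm_sq] with s hs
  rw [integral_infoDensity_cond hp.nonneg hp.noise_pos hs]
  have h1 := hp.noise_pos s
  have h2 : 0 < 1 + c.variance s * p (c.csit s) + ‖c.condMean s‖ ^ 2 * p (c.csit s) := by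
    have := hp.nonneg (c.csit s)
    positivity
  simp only [sub_self, norm_zero]
  rw [hp.log_ratio_eq_rateAt, div_self h2.ne']
  simp [div_self h1.ne']

theorem IsPolicy.isGreatest_forwardGMIs (hp : c.IsPolicy p) :
    IsGreatest (c.forwardGMIs p) (c.rate p) := by
  have hp1 := hp.measurable
  have hp2 := c.measurable_csit
  refine ⟨⟨_, _, c.measurable_condMean, by fun_prop, hp.noise_pos, hp.integrable_infoDensity,
    hp.integral_infoDensity.symm⟩, ?_⟩
  rintro r ⟨a, v, -, -, hv, hi, rfl⟩
  exact hp.gmi_le_rate hv hi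

end FadingChannel

/-! ### Random coding with a threshold test for an abstract memoryless channel -/

section RandomCoding

variable {A B O : Type*} [MeasurableSpace A] [MeasurableSpace B] [MeasurableSpace O]

/-- The strong law needs one probability space for all block lengths; finite blocks are its initial
coordinates. -/
theorem pi_eq_map_infinitePi (μ : Measure A) [IsProbabilityMeasure μ] (n : ℕ) :
    (Measure.pi fun _ : Fin n => μ)
      = (Measure.infinitePi fun _ : ℕ => μ).map fun ω (i : Fin n) => ω i := by
  rw [Measure.map_infinitePi_infinitePi_of_inj (f := fun i : Fin n => (i : ℕ))
    Fin.val_injective, Measure.infinitePi_eq_pi]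

/-- The weak law of large numbers on finite products. -/
theorem tendsto_pi_sum_lt (μ : Measure A) [IsProbabilityMeasure μ] {f : A → ℝ}
    (hm : Measurable f) (hf : Integrable f μ) {γ : ℝ} (hγ : γ < ∫ x, f x ∂μ) :
    Tendsto (fun n : ℕ => (Measure.pi fun _ : Fin n => μ) {w | ∑ i, f (w i) < n * γ})
      atTop (𝓝 0) := by
  set ν := Measure.infinitePi fun _ : ℕ => μ with hν
  have hind : iIndepFun (fun (i : ℕ) (ω : ℕ → A) => f (ω i)) ν :=
    iIndepFun_infinitePi fun _ => hm
  have hlaw : ∀ i : ℕ, MeasurePreserving (fun ω : ℕ → A => ω i) ν μ := fun i =>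
    measurePreserving_eval_infinitePi (fun _ : ℕ => μ) i
  have hmi : ∀ i : ℕ, Measurable fun ω : ℕ → A => f (ω i) := fun i => by fun_prop
  have hident : ∀ i : ℕ, IdentDistrib (fun ω : ℕ → A => f (ω i)) (fun ω => f (ω 0)) ν ν :=
    fun i => ⟨(hmi i).aemeasurable, (hmi 0).aemeasurable, by
      have h : ∀ j : ℕ, ν.map (fun ω : ℕ → A => f (ω j)) = μ.map f := fun j => by
        rw [← (hlaw j).map_eq, Measure.map_map hm (hlaw j).measurable]; rfl
      rw [h i, h 0]⟩
  have hint : Integrable (fun ω : ℕ → A => f (ω 0)) ν := (hlaw 0).integrable_comp_of_integrable hf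
  have hmean : ∫ ω, f (ω 0) ∂ν = ∫ x, f x ∂μ := by
    rw [← (hlaw 0).map_eq, integral_map (hlaw 0).measurable.aemeasurable hm.aestronglyMeasurable]
  have hslln := strong_law_ae_real (fun (i : ℕ) (ω : ℕ → A) => f (ω i)) hint
    (fun i j hij => hind.indepFun hij) hident
  have htim := tendstoInMeasure_of_tendsto_ae (μ := ν)
    (f := fun (n : ℕ) (ω : ℕ → A) => (∑ i ∈ Finset.range n, f (ω i)) / n)
    (g := fun _ => ∫ ω, f (ω 0) ∂ν)
    (fun n => Measurable.aestronglyMeasurable (by fun_prop)) hslln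
  rw [tendstoInMeasure_iff_dist] at htim
  -- A sum below `n * γ` puts the empirical mean at least this far from its limit.
  have h0 := htim (∫ x, f x ∂μ - γ) (by linarith)
  refine tendsto_of_tendsto_of_tendsto_of_le_of_le' tendsto_const_nhds h0
    (Eventually.of_forall fun _ => zero_le) ?_
  filter_upwards [eventually_gt_atTop 0] with n hn
  rw [pi_eq_map_infinitePi, Measure.map_apply (by fun_prop)
    (measurableSet_lt (by fun_prop) measurable_const)]
  refine measure_mono fun ω hω => ?_
  simp only [Set.preimage_ofPred_eq, Set.mem_ofPred_eq, hmean] at hω ⊢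
  rw [Fin.sum_univ_eq_sum_range (fun i => f (ω i))] at hω
  have hn' : (0 : ℝ) < n := by exact_mod_cast hn
  have : (∑ i ∈ Finset.range n, f (ω i)) / n < γ := by
    rw [div_lt_iff₀ hn']; linarith
  rw [Real.dist_eq, abs_sub_comm]
  exact le_trans (by linarith) (le_abs_self _)

/-- An independent codeword passes the threshold test with an exponentially small probability. -/
theorem pi_threshold_le {Ω : Type*} (κ : Measure B) [IsProbabilityMeasure κ] {ι : B → Ω → ℝ}
    (hexp : ∀ o, ∫ b, Real.exp (ι b o) ∂κ = 1) {n : ℕ} (γ : ℝ) (o : Fin n → Ω) :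
    (Measure.pi fun _ : Fin n => κ) {b | n * γ ≤ ∑ i, ι (b i) (o i)}
      ≤ ENNReal.ofReal (Real.exp (-(n * γ))) := by
  have hint : ∀ o, Integrable (fun b => Real.exp (ι b o)) κ := fun o =>
    Integrable.of_integral_ne_zero (by rw [hexp]; exact one_ne_zero)
  have hprod : Integrable (fun b : Fin n → B => ∏ i, Real.exp (ι (b i) (o i)))
      (Measure.pi fun _ : Fin n => κ) :=
    Integrable.fintype_prod (f := fun i b => Real.exp (ι b (o i))) fun i => hint (o i)
  have hone : ∫ b : Fin n → B, ∏ i, Real.exp (ι (b i) (o i)) ∂(Measure.pi fun _ : Fin n => κ)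
      = 1 := by
    rw [integral_fintype_prod_eq_prod (fun i b => Real.exp (ι b (o i)))]
    simp [hexp]
  -- Markov's inequality for the product of the exponentials, which has mean one by independence.
  have hmk := mul_meas_ge_le_integral_of_nonneg
    (ae_of_all _ fun b => Finset.prod_nonneg fun i _ => (Real.exp_pos _).le) hprod
    (Real.exp (n * γ))
  rw [hone] at hmk
  have hset : {b : Fin n → B | Real.exp (n * γ) ≤ ∏ i, Real.exp (ι (b i) (o i))}
      = {b | n * γ ≤ ∑ i, ι (b i) (o i)} := by
    ext b
    simp only [Set.mem_ofPred_eq, ← Real.exp_sum, Real.exp_le_exp]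
  rw [hset] at hmk
  rw [ENNReal.le_ofReal_iff_toReal_le (measure_ne_top _ _) (Real.exp_pos _).le, Real.exp_neg,
    ← one_div, le_div_iff₀ (Real.exp_pos _), mul_comm]
  exact hmk

/-- The noise realizations for which the threshold test does not single out the message `m`. -/
def badNoise (out : A → B → O) (ι : B → O → ℝ) (γ : ℝ) {n M : ℕ} (u : Fin M → Fin n → B)
    (m : Fin M) : Set (Fin n → A) :=
  {w | ∑ i, ι (u m i) (out (w i) (u m i)) < n * γ ∨
    ∃ m' ≠ m, n * γ ≤ ∑ i, ι (u m' i) (out (w i) (u m i))}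

theorem lintegral_pi_eval {ι : Type*} [Fintype ι] (κ : Measure B) [IsProbabilityMeasure κ] (i : ι)
    {f : B → ℝ≥0∞} (hf : Measurable f) :
    ∫⁻ u, f (u i) ∂(Measure.pi fun _ : ι => κ) = ∫⁻ b, f b ∂κ :=
  (measurePreserving_eval (fun _ : ι => κ) i).lintegral_comp hf

/-- Distinct codewords are independent; the union bound uses no more than this pairwise statement.
-/
theorem lintegral_pi_eval_pair {ι : Type*} [Fintype ι] (κ : Measure B) [IsProbabilityMeasure κ]
    {i j : ι} (hij : i ≠ j) {f : B × B → ℝ≥0∞} (hf : Measurable f) :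
    ∫⁻ u, f (u i, u j) ∂(Measure.pi fun _ : ι => κ) = ∫⁻ b, f b ∂(κ.prod κ) := by
  rw [← Measure.infinitePi_map_eval_prod (P := fun _ : ι => κ) hij,
    lintegral_map hf (by fun_prop), Measure.infinitePi_eq_pi]

variable (μ : Measure A) [IsProbabilityMeasure μ] (κ : Measure B) [IsProbabilityMeasure κ]
  {out : A → B → O} {ι : B → O → ℝ}

theorem measurable_test (hout : Measurable out.uncurry) (hι : Measurable ι.uncurry) (n : ℕ) :
    Measurable fun x : ((Fin n → B) × (Fin n → B)) × (Fin n → A) =>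
      ∑ i, ι (x.1.2 i) (out (x.2 i) (x.1.1 i)) := by
  refine Finset.measurable_sum _ fun i _ => ?_
  have h1 : Measurable fun x : ((Fin n → B) × (Fin n → B)) × (Fin n → A) =>
      out (x.2 i) (x.1.1 i) :=
    hout.comp (by fun_prop : Measurable fun x : ((Fin n → B) × (Fin n → B)) × (Fin n → A) =>
      (x.2 i, x.1.1 i))
  exact hι.comp (Measurable.prodMk (by fun_prop : Measurable fun x :
    ((Fin n → B) × (Fin n → B)) × (Fin n → A) => x.1.2 i) h1)

/-- Averaged over codebooks, only codeword `m` matters, and its letters paired with the noise are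
i.i.d.; this is the form to which the law of large numbers applies. -/
theorem lintegral_miss (hout : Measurable out.uncurry) (hι : Measurable ι.uncurry) (γ : ℝ)
    {n M : ℕ} (m : Fin M) :
    ∫⁻ u, (Measure.pi fun _ : Fin n => μ) {w | ∑ i, ι (u m i) (out (w i) (u m i)) < n * γ}
      ∂(Measure.pi fun _ : Fin M => Measure.pi fun _ : Fin n => κ)
      = (Measure.pi fun _ : Fin n => μ.prod κ)
        {x | ∑ i, ι (x i).2 (out (x i).1 (x i).2) < n * γ} := by
  have ht := measurable_test hout hι n
  have hs : MeasurableSet {x : (Fin n → B) × (Fin n → A) |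
      ∑ i, ι (x.1 i) (out (x.2 i) (x.1 i)) < n * γ} :=
    measurableSet_lt (ht.comp (by fun_prop : Measurable
      fun x : (Fin n → B) × (Fin n → A) => ((x.1, x.1), x.2))) measurable_const
  have hs' : MeasurableSet {x : (Fin n → A) × (Fin n → B) |
      ∑ i, ι (x.2 i) (out (x.1 i) (x.2 i)) < n * γ} := measurable_swap hs
  rw [lintegral_pi_eval (Measure.pi fun _ : Fin n => κ) m
    (f := fun b => (Measure.pi fun _ : Fin n => μ)
      {w | ∑ i, ι (b i) (out (w i) (b i)) < n * γ}) (measurable_measure_prodMk_left hs)]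
  refine Eq.trans ?_ ((measurePreserving_arrowProdEquivProdArrow A B (Fin n) (fun _ => μ)
    (fun _ => κ)).measure_preimage hs'.nullMeasurableSet).symm
  rw [Measure.prod_apply_symm hs']
  rfl

/-- Once the sent codeword and the noise are fixed, so is the output, while the competing codeword
is still independent of it. The bound of `pi_threshold_le` is uniform in the output, so the channel
law is irrelevant here. -/
theorem lintegral_false_alarm_le (hout : Measurable out.uncurry) (hι : Measurable ι.uncurry)
    (hexp : ∀ o, ∫ b, Real.exp (ι b o) ∂κ = 1) (γ : ℝ) {n M : ℕ} {m m' : Fin M} (hm : m' ≠ m) :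
    ∫⁻ u, (Measure.pi fun _ : Fin n => μ) {w | n * γ ≤ ∑ i, ι (u m' i) (out (w i) (u m i))}
      ∂(Measure.pi fun _ : Fin M => Measure.pi fun _ : Fin n => κ)
      ≤ ENNReal.ofReal (Real.exp (-(n * γ))) := by
  have ht := measurable_test hout hι n
  have hs : MeasurableSet {x : ((Fin n → B) × (Fin n → B)) × (Fin n → A) |
      n * γ ≤ ∑ i, ι (x.1.2 i) (out (x.2 i) (x.1.1 i))} :=
    measurableSet_le measurable_const ht
  have hf : Measurable fun b : (Fin n → B) × (Fin n → B) => (Measure.pi fun _ : Fin n => μ)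
      {w | n * γ ≤ ∑ i, ι (b.2 i) (out (w i) (b.1 i))} := measurable_measure_prodMk_left hs
  rw [lintegral_pi_eval_pair (Measure.pi fun _ : Fin n => κ) hm.symm hf,
    lintegral_prod _ hf.aemeasurable]
  refine (lintegral_mono fun b => ?_).trans_eq (by rw [lintegral_const, measure_univ, mul_one])
  have hsb : MeasurableSet {x : (Fin n → B) × (Fin n → A) |
      n * γ ≤ ∑ i, ι (x.1 i) (out (x.2 i) (b i))} :=
    hs.preimage (by fun_prop : Measurable
      fun x : (Fin n → B) × (Fin n → A) => ((b, x.1), x.2))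
  have e := Measure.prod_apply (μ := Measure.pi fun _ : Fin n => κ)
    (ν := Measure.pi fun _ : Fin n => μ) hsb
  rw [Measure.prod_apply_symm hsb] at e
  refine e.symm.le.trans ?_
  refine (lintegral_mono fun w => ?_).trans_eq (by rw [lintegral_const, measure_univ, mul_one])
  exact pi_threshold_le κ hexp γ fun i => out (w i) (b i)

theorem lintegral_badNoise_le (hout : Measurable out.uncurry) (hι : Measurable ι.uncurry)
    (hexp : ∀ o, ∫ b, Real.exp (ι b o) ∂κ = 1) (γ : ℝ) {n M : ℕ} (m : Fin M) :
    ∫⁻ u, (Measure.pi fun _ : Fin n => μ) (badNoise out ι γ u m)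
      ∂(Measure.pi fun _ : Fin M => Measure.pi fun _ : Fin n => κ)
      ≤ (Measure.pi fun _ : Fin n => μ.prod κ)
        {x | ∑ i, ι (x i).2 (out (x i).1 (x i).2) < n * γ}
        + ((M - 1 : ℕ) : ℝ≥0∞) * ENNReal.ofReal (Real.exp (-(n * γ))) := by
  have ht := measurable_test hout hι n
  have m1 : Measurable fun u : Fin M → Fin n → B => (Measure.pi fun _ : Fin n => μ)
      {w | ∑ i, ι (u m i) (out (w i) (u m i)) < n * γ} :=
    measurable_measure_prodMk_left (s := {x : (Fin M → Fin n → B) × (Fin n → A) |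
      ∑ i, ι (x.1 m i) (out (x.2 i) (x.1 m i)) < n * γ})
      (measurableSet_lt (ht.comp (by fun_prop : Measurable
        fun x : (Fin M → Fin n → B) × (Fin n → A) => ((x.1 m, x.1 m), x.2))) measurable_const)
  have m2 : ∀ m', Measurable fun u : Fin M → Fin n → B => (Measure.pi fun _ : Fin n => μ)
      {w | n * γ ≤ ∑ i, ι (u m' i) (out (w i) (u m i))} := fun m' =>
    measurable_measure_prodMk_left (s := {x : (Fin M → Fin n → B) × (Fin n → A) |
      n * γ ≤ ∑ i, ι (x.1 m' i) (out (x.2 i) (x.1 m i))})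
      (measurableSet_le measurable_const (ht.comp (by fun_prop : Measurable
        fun x : (Fin M → Fin n → B) × (Fin n → A) => ((x.1 m, x.1 m'), x.2))))
  have hsub : ∀ u : Fin M → Fin n → B, (Measure.pi fun _ : Fin n => μ) (badNoise out ι γ u m)
      ≤ (Measure.pi fun _ : Fin n => μ) {w | ∑ i, ι (u m i) (out (w i) (u m i)) < n * γ}
        + ∑ m' ∈ Finset.univ.erase m, (Measure.pi fun _ : Fin n => μ)
          {w | n * γ ≤ ∑ i, ι (u m' i) (out (w i) (u m i))} := fun u => by
    refine le_trans (measure_mono (t := {w | ∑ i, ι (u m i) (out (w i) (u m i)) < n * γ} ∪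
      ⋃ m' ∈ Finset.univ.erase m, {w | n * γ ≤ ∑ i, ι (u m' i) (out (w i) (u m i))}) ?_)
      ((measure_union_le _ _).trans (by gcongr; exact measure_biUnion_finset_le _ _))
    rintro w (hw | ⟨m', hm', hw⟩)
    · exact Or.inl hw
    · refine Or.inr ?_
      simp only [Set.mem_iUnion]
      exact ⟨m', by simp [hm'], hw⟩
  refine (lintegral_mono hsub).trans ?_
  rw [lintegral_add_left m1, lintegral_miss μ κ hout hι, lintegral_finsetSum _ fun m' _ => m2 m']
  gcongr
  refine (Finset.sum_le_card_nsmul _ _ (ENNReal.ofReal (Real.exp (-(n * γ))))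
    fun m' hm' => lintegral_false_alarm_le μ κ hout hι hexp γ (Finset.ne_of_mem_erase hm')).trans ?_
  rw [Finset.card_erase_of_mem (Finset.mem_univ m), Finset.card_univ, Fintype.card_fin,
    nsmul_eq_mul]

theorem measurable_measure_badNoise (hout : Measurable out.uncurry) (hι : Measurable ι.uncurry)
    (γ : ℝ) {n M : ℕ} (m : Fin M) :
    Measurable fun u : Fin M → Fin n → B =>
      (Measure.pi fun _ : Fin n => μ) (badNoise out ι γ u m) := by
  have ht := measurable_test hout hι n
  have hs : ∀ m', Measurable fun x : (Fin M → Fin n → B) × (Fin n → A) =>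
      ∑ i, ι (x.1 m' i) (out (x.2 i) (x.1 m i)) := fun m' =>
    ht.comp (by fun_prop : Measurable
      fun x : (Fin M → Fin n → B) × (Fin n → A) => ((x.1 m, x.1 m'), x.2))
  have h := (measurableSet_lt (hs m) (measurable_const (a := n * γ))).union
    (MeasurableSet.iUnion fun m' => MeasurableSet.iUnion fun _ : m' ≠ m =>
      measurableSet_le (measurable_const (a := n * γ)) (hs m'))
  convert measurable_measure_prodMk_left (ν := Measure.pi fun _ : Fin n => μ) h using 3 with u
  ext w
  simp [badNoise]

/-- A measurable decoder for the threshold test. -/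
theorem exists_threshold_decoder (hι : Measurable ι.uncurry) (γ : ℝ) {n M : ℕ} [Nonempty (Fin M)]
    (u : Fin M → Fin n → B) :
    ∃ dec : (Fin n → O) → Fin M, Measurable dec ∧ ∀ m o, n * γ ≤ ∑ i, ι (u m i) (o i) →
      (∀ m' ≠ m, ∑ i, ι (u m' i) (o i) < n * γ) → dec o = m := by
  have hmeas : ∀ m, Measurable fun o : Fin n → O => ∑ i, ι (u m i) (o i) := fun m =>
    Finset.measurable_sum _ fun i _ => hι.comp (by fun_prop : Measurable
      fun o : Fin n → O => (u m i, o i))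
  -- The regions where exactly one codeword passes are disjoint for different messages, so constant
  -- decisions on them glue.
  obtain ⟨dec, h1, h2⟩ := exists_measurable_piecewise
    (fun m => {o : Fin n → O | n * γ ≤ ∑ i, ι (u m i) (o i)} ∩
      ⋂ m' ∈ {m' | m' ≠ m}, {o | ∑ i, ι (u m' i) (o i) < n * γ})
    (fun m => (measurableSet_le measurable_const (hmeas m)).inter
      (MeasurableSet.biInter (Set.to_countable _) fun m' _ =>
        measurableSet_lt (hmeas m') measurable_const))
    (fun m _ => m) (fun m => measurable_const) (by
      rintro m m' hne o ⟨⟨h1, h2⟩, h3, h4⟩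
      simp only [Set.mem_iInter] at h2
      exact absurd (Set.mem_ofPred_eq.mp (h2 m' hne.symm)) (not_lt.2 (Set.mem_ofPred_eq.mp h3)))
  refine ⟨dec, h1, fun m o ho ho' => h2 m ⟨ho, ?_⟩⟩
  simp only [Set.mem_iInter]
  exact ho'

end RandomCoding

/-! ### Achievability of the rate over the fading channel -/

namespace FadingChannel

variable {R T : Type*} [MeasurableSpace R] [MeasurableSpace T] {c : FadingChannel R T} {p : T → ℝ}

/-- The channel output and the CSIR when the input is `√p (S_T) u`. -/
def letterOutput (c : FadingChannel R T) (p : T → ℝ) (w : (R × ℂ) × ℂ) (u : ℂ) : ℂ × R :=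
  (w.1.2 * (Real.sqrt (p (c.csit w.1.1)) * u) + w.2, w.1.1)

/-- The decoding metric: the information density of the optimal auxiliary model. -/
def letterMetric (c : FadingChannel R T) (p : T → ℝ) (u : ℂ) (o : ℂ × R) : ℝ :=
  Real.log (auxDensity (c.condMean o.2) (1 + c.variance o.2 * p (c.csit o.2))
    (Real.sqrt (p (c.csit o.2)) * u) o.1 /
      auxOutput (p (c.csit o.2)) (c.condMean o.2) (1 + c.variance o.2 * p (c.csit o.2)) o.1)

theorem IsPolicy.measurable_letterOutput (hp : c.IsPolicy p) :
    Measurable (c.letterOutput p).uncurry := by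
  have hp1 := hp.measurable
  have hp2 := c.measurable_csit
  unfold letterOutput Function.uncurry
  fun_prop

theorem IsPolicy.measurable_letterMetric (hp : c.IsPolicy p) :
    Measurable (c.letterMetric p).uncurry := by
  have hp1 := hp.measurable
  have hp2 := c.measurable_csit
  have : (c.letterMetric p).uncurry = fun x : ℂ × (ℂ × R) => _ := funext fun x =>
    log_auxDensity_div_auxOutput (hp.nonneg _) (hp.noise_pos x.2.2) (c.condMean x.2.2)
      (Real.sqrt (p (c.csit x.2.2)) * x.1) x.2.1
  rw [this]
  fun_prop

theorem auxDensity_pos {v : ℝ} (hv : 0 < v) (a x y : ℂ) : 0 < auxDensity a v x y := by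
  unfold auxDensity
  have := Real.pi_pos
  positivity

theorem auxOutput_pos {Q v : ℝ} (hQ : 0 ≤ Q) (hv : 0 < v) (a y : ℂ) : 0 < auxOutput Q a v y := by
  rw [auxOutput_eq hQ hv]
  have := Real.pi_pos
  positivity

/-- The denominator of the metric is by definition the average of its numerator over the input.
Nothing about the true law of `H` enters, which is why a mismatched metric still yields a valid
rate. -/
theorem IsPolicy.integral_exp_letterMetric (hp : c.IsPolicy p) (o : ℂ × R) :
    ∫ u, Real.exp (c.letterMetric p u o) ∂cscg = 1 := by
  have hv := hp.noise_pos o.2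
  have ho := auxOutput_pos (hp.nonneg (c.csit o.2)) hv (c.condMean o.2) o.1
  simp only [letterMetric]
  simp_rw [fun u : ℂ => Real.exp_log (div_pos (auxDensity_pos hv (c.condMean o.2)
    (Real.sqrt (p (c.csit o.2)) * u) o.1) ho)]
  rw [integral_div]
  exact div_self ho.ne'

theorem measurePreserving_jointLaw (c : FadingChannel R T) :
    MeasurePreserving (fun x : ((R × ℂ) × ℂ) × ℂ => (x.1.1, (x.2, x.1.2)))
      ((c.law.prod cscg).prod cscg) c.jointLaw :=
  ((MeasurePreserving.id c.law).prod Measure.measurePreserving_swap).comp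
    (measurePreserving_prodAssoc c.law cscg cscg)

theorem IsPolicy.integrable_letterMetric (hp : c.IsPolicy p) :
    Integrable (fun x : ((R × ℂ) × ℂ) × ℂ => c.letterMetric p x.2 (c.letterOutput p x.1 x.2))
      ((c.law.prod cscg).prod cscg) :=
  c.measurePreserving_jointLaw.integrable_comp_of_integrable hp.integrable_infoDensity

theorem IsPolicy.integral_letterMetric (hp : c.IsPolicy p) :
    ∫ x, c.letterMetric p x.2 (c.letterOutput p x.1 x.2) ∂((c.law.prod cscg).prod cscg)
      = c.rate p := by
  rw [← hp.integral_infoDensity, ← c.measurePreserving_jointLaw.map_eq,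
    integral_map c.measurePreserving_jointLaw.measurable.aemeasurable]
  · rfl
  · rw [c.measurePreserving_jointLaw.map_eq]
    exact hp.integrable_infoDensity.aestronglyMeasurable

/-- The code that sends `√p (S_T) u` for the codeword letter `u`. -/
def scaledCode (c : FadingChannel R T) (hp : c.IsPolicy p) {n M : ℕ} (u : Fin M → Fin n → ℂ)
    (dec : (Fin n → ℂ × R) → Fin M) (hdec : Measurable dec) : BlockCode R T n M where
  encode m i t := Real.sqrt (p (t ⟨i, Set.self_mem_Iic⟩)) * u m i
  measurable_encode m i := by
    have := hp.measurable
    fun_prop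
  decode := dec
  measurable_decode := hdec

theorem lintegral_enorm_sq_cscg : ∫⁻ z, ‖z‖ₑ ^ 2 ∂cscg = 1 := by
  have h := ofReal_integral_eq_lintegral_ofReal integrable_norm_sq_cscg
    (ae_of_all _ fun z => by positivity)
  rw [integral_norm_sq_cscg, ENNReal.ofReal_one] at h
  rw [h]
  refine lintegral_congr fun z => ?_
  rw [← ofReal_norm, ENNReal.ofReal_pow (norm_nonneg _)]

theorem IsPolicy.lintegral_ofReal (hp : c.IsPolicy p) :
    ∫⁻ s, ENNReal.ofReal (p (c.csit s)) ∂c.lawR = ENNReal.ofReal (c.meanPower p) := by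
  rw [hp.meanPower_eq, ofReal_integral_eq_lintegral_ofReal hp.integrable_comp
    (ae_of_all _ fun s => hp.nonneg _)]

theorem IsPolicy.blockPower_scaledCode (hp : c.IsPolicy p) {n M : ℕ} (u : Fin M → Fin n → ℂ)
    (dec : (Fin n → ℂ × R) → Fin M) (hdec : Measurable dec) :
    c.blockPower (c.scaledCode hp u dec hdec)
      = ENNReal.ofReal (c.meanPower p) * (∑ m, ∑ i, ‖u m i‖ₑ ^ 2) / (n * M) := by
  have hp1 := hp.measurable
  have hp2 := c.measurable_csit
  unfold blockPower
  congr 1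
  rw [Finset.mul_sum]
  refine Finset.sum_congr rfl fun m _ => ?_
  rw [Finset.mul_sum]
  refine Finset.sum_congr rfl fun i _ => ?_
  have e1 : ∀ w : Fin n → (R × ℂ) × ℂ, ‖c.input (c.scaledCode hp u dec hdec) m w i‖ₑ ^ 2
      = (fun x : (R × ℂ) × ℂ => ENNReal.ofReal (p (c.csit x.1.1)) * ‖u m i‖ₑ ^ 2) (w i) :=
    fun w => by
      have : c.input (c.scaledCode hp u dec hdec) m w i
        = Real.sqrt (p (c.csit (w i).1.1)) * u m i := rfl
      rw [this, enorm_mul, mul_pow, ← ofReal_norm, Complex.norm_real,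
        Real.norm_of_nonneg (Real.sqrt_nonneg _),
        ← ENNReal.ofReal_pow (Real.sqrt_nonneg _), Real.sq_sqrt (hp.nonneg _)]
  simp_rw [e1]
  rw [blockLaw, lintegral_pi_eval (c.law.prod cscg) i
      (f := fun x : (R × ℂ) × ℂ => ENNReal.ofReal (p (c.csit x.1.1)) * ‖u m i‖ₑ ^ 2) (by fun_prop),
    lintegral_mul_const _ (by fun_prop), ← hp.lintegral_ofReal]
  congr 1
  rw [lintegral_prod _ (by fun_prop)]
  simp only [lintegral_const, measure_univ, mul_one]
  rw [lawR, Measure.fst, lintegral_map (by fun_prop) measurable_fst]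

/-- The probability that the true codeword fails the threshold test. -/
def missProb (c : FadingChannel R T) (p : T → ℝ) (γ : ℝ) (n : ℕ) : ℝ≥0∞ :=
  (Measure.pi fun _ : Fin n => (c.law.prod cscg).prod cscg)
    {x | ∑ i, c.letterMetric p (x i).2 (c.letterOutput p (x i).1 (x i).2) < n * γ}

theorem IsPolicy.tendsto_missProb (hp : c.IsPolicy p) {γ : ℝ} (hγ : γ < c.rate p) :
    Tendsto (c.missProb p γ) atTop (𝓝 0) := by
  have h1 : Measurable fun x : ((R × ℂ) × ℂ) × ℂ => c.letterOutput p x.1 x.2 :=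
    hp.measurable_letterOutput
  have h2 : Measurable fun x : ((R × ℂ) × ℂ) × ℂ =>
      c.letterMetric p x.2 (c.letterOutput p x.1 x.2) :=
    Measurable.comp (g := (c.letterMetric p).uncurry)
      (f := fun x : ((R × ℂ) × ℂ) × ℂ => (x.2, c.letterOutput p x.1 x.2))
      hp.measurable_letterMetric (measurable_snd.prodMk h1)
  have h3 := hp.integrable_letterMetric
  rw [← hp.integral_letterMetric] at hγ
  exact tendsto_pi_sum_lt _ h2 h3 hγ

/-- Power and error must be met by the same codebook. The hypothesis bounds the codebook average of
power over `P` plus error over `ε` below one, so some codebook has the sum at most one, and then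
each nonnegative summand is at most one. -/
theorem IsPolicy.exists_code (hp : c.IsPolicy p) {P ε γ : ℝ} (hP : 0 < P) (hε : 0 < ε)
    {n M : ℕ} (hn : n ≠ 0) (hM : M ≠ 0)
    (h : ENNReal.ofReal (c.meanPower p) / ENNReal.ofReal P
      + (c.missProb p γ n + ((M - 1 : ℕ) : ℝ≥0∞) * ENNReal.ofReal (Real.exp (-(n * γ)))) / ENNReal.ofReal ε < 1) :
    ∃ C : BlockCode R T n M, c.blockPower C ≤ ENNReal.ofReal P ∧ c.errorProb C ≤ ε := by
  have : Nonempty (Fin M) := ⟨⟨0, Nat.pos_of_ne_zero hM⟩⟩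
  have hn0 : (n : ℝ≥0∞) ≠ 0 := by exact_mod_cast hn
  have hM0 : (M : ℝ≥0∞) ≠ 0 := by exact_mod_cast hM
  have hP0 : ENNReal.ofReal P ≠ 0 := (ENNReal.ofReal_pos.2 hP).ne'
  have hε0 : ENNReal.ofReal ε ≠ 0 := (ENNReal.ofReal_pos.2 hε).ne'
  have hout := hp.measurable_letterOutput
  have hι := hp.measurable_letterMetric
  set μ := c.law.prod cscg with hμ
  set book := Measure.pi fun _ : Fin M => Measure.pi fun _ : Fin n => cscg with hbook
  set bad : (Fin M → Fin n → ℂ) → Fin M → ℝ≥0∞ := fun u m => (Measure.pi fun _ : Fin n => μ)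
    (badNoise (c.letterOutput p) (c.letterMetric p) γ u m) with hbad
  have hpow : ∫⁻ u, ENNReal.ofReal (c.meanPower p) * (∑ m, ∑ i, ‖u m i‖ₑ ^ 2) / (n * M) ∂book
      = ENNReal.ofReal (c.meanPower p) := by
    simp_rw [div_eq_mul_inv]
    rw [lintegral_mul_const _ (by fun_prop), lintegral_const_mul _ (by fun_prop),
      lintegral_finsetSum _ (fun m _ => by fun_prop)]
    have e : ∀ m, ∫⁻ u, ∑ i, ‖u m i‖ₑ ^ 2 ∂book = n := fun m => by
      rw [lintegral_pi_eval (Measure.pi fun _ : Fin n => cscg) m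
        (f := fun b => ∑ i, ‖b i‖ₑ ^ 2) (by fun_prop), lintegral_finsetSum _
        (fun i _ => by fun_prop)]
      have e' : ∀ i, ∫⁻ b, ‖b i‖ₑ ^ 2 ∂(Measure.pi fun _ : Fin n => cscg) = 1 := fun i => by
        rw [lintegral_pi_eval cscg i (f := fun z => ‖z‖ₑ ^ 2) (by fun_prop),
          lintegral_enorm_sq_cscg]
      simp [e']
    simp_rw [e]
    rw [Finset.sum_const, Finset.card_univ, Fintype.card_fin, nsmul_eq_mul, mul_comm (M : ℝ≥0∞),
      mul_assoc, ENNReal.mul_inv_cancel (mul_ne_zero hn0 hM0)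
        (ENNReal.mul_ne_top (ENNReal.natCast_ne_top n) (ENNReal.natCast_ne_top M)), mul_one]
  have herr : ∫⁻ u, (∑ m, bad u m) / M ∂book
      ≤ c.missProb p γ n + ((M - 1 : ℕ) : ℝ≥0∞) * ENNReal.ofReal (Real.exp (-(n * γ))) := by
    simp_rw [div_eq_mul_inv]
    rw [lintegral_mul_const _ (Finset.measurable_sum _ fun m _ =>
      measurable_measure_badNoise μ hout hι γ m), lintegral_finsetSum _
        (fun m _ => measurable_measure_badNoise μ hout hι γ m), ← div_eq_mul_inv]
    refine ENNReal.div_le_of_le_mul ((Finset.sum_le_card_nsmul _ _ _ fun m _ =>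
      lintegral_badNoise_le μ cscg hout hι hp.integral_exp_letterMetric γ m).trans ?_)
    rw [Finset.card_univ, Fintype.card_fin, nsmul_eq_mul, mul_comm, missProb]
  have hJ : ∫⁻ u, (ENNReal.ofReal (c.meanPower p) * (∑ m, ∑ i, ‖u m i‖ₑ ^ 2) / (n * M)
      / ENNReal.ofReal P + (∑ m, bad u m) / M / ENNReal.ofReal ε) ∂book < 1 := by
    refine lt_of_le_of_lt ?_ h
    have m1 : Measurable fun u : Fin M → Fin n → ℂ =>
      ENNReal.ofReal (c.meanPower p) * (∑ m, ∑ i, ‖u m i‖ₑ ^ 2) / (n * M) := by fun_prop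
    rw [lintegral_add_left (m1.div_const _)]
    simp_rw [div_eq_mul_inv _ (ENNReal.ofReal P), div_eq_mul_inv _ (ENNReal.ofReal ε)]
    rw [lintegral_mul_const _ m1, lintegral_mul_const' _ _ (ENNReal.inv_ne_top.2 hε0), hpow]
    gcongr
  obtain ⟨u, hu⟩ := exists_le_lintegral (μ := book)
    (f := fun u => ENNReal.ofReal (c.meanPower p) * (∑ m, ∑ i, ‖u m i‖ₑ ^ 2) / (n * M)
      / ENNReal.ofReal P + (∑ m, bad u m) / M / ENNReal.ofReal ε)
    (Measurable.aemeasurable (by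
      have := fun m => measurable_measure_badNoise μ hout hι γ (n := n) (M := M) m
      fun_prop))
  have hu1 := hu.trans hJ.le
  obtain ⟨dec, hdec, hdec'⟩ := exists_threshold_decoder hι γ u
  refine ⟨c.scaledCode hp u dec hdec, ?_, ?_⟩
  · rw [hp.blockPower_scaledCode]
    have := (le_self_add).trans hu1
    rwa [ENNReal.div_le_iff hP0 ENNReal.ofReal_ne_top, one_mul] at this
  · have h2 := (le_add_self).trans hu1
    rw [ENNReal.div_le_iff hε0 ENNReal.ofReal_ne_top, one_mul] at h2
    have h3 : ∀ m, (c.blockLaw n) {w | (c.scaledCode hp u dec hdec).decode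
        (c.output (c.scaledCode hp u dec hdec) m w) ≠ m} ≤ bad u m := fun m => by
      refine measure_mono fun w hw => ?_
      by_contra hnot
      simp only [badNoise, Set.mem_ofPred_eq, not_or, not_lt, not_exists, not_and, not_le] at hnot
      exact hw (hdec' m (fun i => c.letterOutput p (w i) (u m i)) hnot.1 hnot.2)
    have h4 : c.errorProb (c.scaledCode hp u dec hdec) = ((∑ m, (c.blockLaw n)
        {w | (c.scaledCode hp u dec hdec).decode
          (c.output (c.scaledCode hp u dec hdec) m w) ≠ m}) / M : ℝ≥0∞).toReal := by
      have : IsProbabilityMeasure (c.blockLaw n) :=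
        inferInstanceAs (IsProbabilityMeasure (Measure.pi fun _ : Fin n => c.law.prod cscg))
      rw [ENNReal.toReal_div, ENNReal.toReal_sum fun m _ => measure_ne_top _ _]
      simp [errorProb, measureReal_def]
    rw [h4]
    refine ENNReal.toReal_le_of_le_ofReal hε.le (le_trans ?_ h2)
    gcongr with m
    exact h3 m

theorem IsPolicy.const_mul (hp : c.IsPolicy p) {a : ℝ} (ha : 0 ≤ a) :
    c.IsPolicy fun t => a * p t :=
  ⟨hp.measurable.const_mul a, fun t => mul_nonneg ha (hp.nonneg t), hp.integrable.const_mul a⟩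

/-- Concavity of the logarithm on the segment from `1` to `1 + x`. -/
theorem mul_log_one_add_le {a x : ℝ} (ha : 0 ≤ a) (ha1 : a ≤ 1) (hx : 0 ≤ x) :
    a * Real.log (1 + x) ≤ Real.log (1 + a * x) := by
  have h := strictConcaveOn_log_Ioi.concaveOn.2 (x := 1 + x) (y := 1)
    (Set.mem_Ioi.2 (by positivity)) (Set.mem_Ioi.2 one_pos) ha (sub_nonneg.2 ha1) (by ring)
  simp only [smul_eq_mul, Real.log_one, mul_zero, add_zero] at h
  refine h.trans_eq ?_
  ring_nf

/-- Scaling the powers by `a ≤ 1` scales the rate by `a` at worst. -/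
theorem IsPolicy.mul_rate_le (hp : c.IsPolicy p) {a : ℝ} (ha : 0 ≤ a) (ha1 : a ≤ 1) :
    a * c.rate p ≤ c.rate fun t => a * p t := by
  rw [rate, ← integral_const_mul]
  refine integral_mono (hp.integrable_rateAt.const_mul a) (hp.const_mul ha).integrable_rateAt
    fun s => ?_
  have h1 := c.gain_nonneg s
  have h2 := c.variance_nonneg s
  have h3 := hp.nonneg (c.csit s)
  refine (mul_log_one_add_le ha ha1 (by positivity)).trans (Real.log_le_log (by positivity) ?_)
  simp only
  rw [← mul_div_assoc, ← mul_assoc, mul_comm a, mul_assoc]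
  gcongr
  exact mul_le_of_le_one_left h3 ha1

/-- For zero power the quotient by `P` in `exists_code` is useless; a single message and the zero
input suffice. -/
theorem achievable_zero (c : FadingChannel R T) : c.Achievable 0 0 := by
  intro ε hε
  refine Eventually.of_forall fun n => ⟨1, ⟨fun _ _ _ => 0, fun _ _ => measurable_const,
    fun _ => 0, measurable_const⟩, ?_, ?_, ?_⟩
  · rw [Nat.cast_one, Real.exp_le_one_iff]
    have : (0 : ℝ) ≤ n := n.cast_nonneg
    nlinarith
  · simp [blockPower, input]
  · simpa [errorProb, Subsingleton.elim (0 : Fin 1) _] using hε.le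

theorem IsPolicy.achievable (hp : c.IsPolicy p) {P : ℝ} (hm : c.meanPower p = P) :
    c.Achievable P (c.rate p) := by
  have hP0 : 0 ≤ P := hm ▸ integral_nonneg hp.nonneg
  rcases hP0.eq_or_lt with rfl | hP
  · have h0 : p =ᵐ[c.lawT] 0 := (integral_eq_zero_iff_of_nonneg hp.nonneg hp.integrable).1 hm
    have h1 : c.rate p = 0 := by
      rw [rate]
      refine integral_eq_zero_of_ae ?_
      filter_upwards [ae_of_ae_map c.measurable_csit.aemeasurable h0] with s hs
      simp only [Pi.zero_apply] at hs
      simp [rateAt, hs]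
    rw [h1]
    exact c.achievable_zero
  intro ε hε
  set r := c.rate p with hr
  have hr0 : 0 ≤ r := rate_nonneg hp.nonneg
  -- Spending only `(1 - δ) * P` leaves a slack `δ` for the error term in `exists_code`, at a rate
  -- loss of at most `ε / 4`.
  obtain ⟨δ, hδ0, hδ1, hδr⟩ : ∃ δ : ℝ, 0 < δ ∧ δ ≤ 1 ∧ δ * r ≤ ε / 4 := by
    refine ⟨min 1 (ε / (4 * (r + 1))), by positivity, min_le_left _ _, ?_⟩
    calc min 1 (ε / (4 * (r + 1))) * r ≤ ε / (4 * (r + 1)) * (r + 1) := by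
          gcongr
          · exact min_le_right _ _
          · linarith
      _ = ε / 4 := by field_simp
  have ha0 : 0 ≤ 1 - δ := by linarith
  have hq := hp.const_mul ha0
  set q : T → ℝ := fun t => (1 - δ) * p t with hqdef
  have hqm : c.meanPower q = (1 - δ) * P := by
    rw [← hm, meanPower, meanPower, ← integral_const_mul]
  have hqr : r - ε / 4 ≤ c.rate q := by
    have := hp.mul_rate_le ha0 (by linarith)
    linarith
  -- The threshold `r - ε / 2` lies below the reduced rate and above the code rate `r - ε`, so
  -- misses and false alarms both vanish.
  have hlim1 := hq.tendsto_missProb (γ := r - ε / 2) (by linarith)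
  have hlim2 : Tendsto (fun n : ℕ => ENNReal.ofReal (Real.exp (-(n * (ε / 2))))) atTop (𝓝 0) := by
    rw [← ENNReal.ofReal_zero]
    refine (ENNReal.continuous_ofReal.tendsto 0).comp ?_
    refine Real.tendsto_exp_neg_atTop_nhds_zero.comp ?_
    exact tendsto_natCast_atTop_atTop.atTop_mul_const (by positivity)
  have hlim := (hlim1.add hlim2)
  rw [add_zero] at hlim
  have hpos : (0 : ℝ≥0∞) < ENNReal.ofReal δ * ENNReal.ofReal ε :=
    ENNReal.mul_pos (ENNReal.ofReal_pos.2 hδ0).ne' (ENNReal.ofReal_pos.2 hε).ne'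
  filter_upwards [hlim.eventually_lt_const hpos, eventually_ne_atTop 0] with n hn hn0
  set M := ⌈Real.exp (n * (r - ε))⌉₊ with hMdef
  have hM0 : M ≠ 0 := (Nat.ceil_pos.2 (Real.exp_pos _)).ne'
  -- Counting only the `M - 1` competitors absorbs the rounding up in `M`.
  have hM1 : ((M - 1 : ℕ) : ℝ) ≤ Real.exp (n * (r - ε)) := by
    rw [Nat.cast_sub (Nat.one_le_iff_ne_zero.2 hM0), Nat.cast_one]
    have := Nat.ceil_lt_add_one (Real.exp_pos (n * (r - ε))).le
    linarith
  refine ⟨M, ?_⟩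
  have hfa : ((M - 1 : ℕ) : ℝ≥0∞) * ENNReal.ofReal (Real.exp (-(n * (r - ε / 2))))
      ≤ ENNReal.ofReal (Real.exp (-(n * (ε / 2)))) := by
    rw [← ENNReal.ofReal_natCast, ← ENNReal.ofReal_mul (Nat.cast_nonneg _)]
    refine ENNReal.ofReal_le_ofReal ?_
    calc ((M - 1 : ℕ) : ℝ) * Real.exp (-(n * (r - ε / 2)))
        ≤ Real.exp (n * (r - ε)) * Real.exp (-(n * (r - ε / 2))) := by gcongr
      _ = Real.exp (-(n * (ε / 2))) := by rw [← Real.exp_add]; congr 1; ring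
  obtain ⟨C, hC1, hC2⟩ := hq.exists_code (P := P) (ε := ε) (γ := r - ε / 2) hP hε hn0 hM0 (by
    rw [hqm, ← ENNReal.ofReal_div_of_pos hP, mul_div_cancel_right₀ _ hP.ne']
    have hsum : ENNReal.ofReal (1 - δ) + ENNReal.ofReal δ = 1 := by
      rw [← ENNReal.ofReal_add ha0 hδ0.le]; simp
    rw [← hsum]
    refine ENNReal.add_lt_add_left ENNReal.ofReal_ne_top ?_
    rw [ENNReal.div_lt_iff (Or.inl (ENNReal.ofReal_pos.2 hε).ne') (Or.inl ENNReal.ofReal_ne_top)]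
    refine lt_of_le_of_lt ?_ hn
    gcongr)
  exact ⟨C, Nat.le_ceil _, hC1, hC2⟩

end FadingChannel

/-! ### The derivative of the rate in the power -/

/-- The derivative of `log (1 + g Q / (1 + σ² Q))` in `Q`. -/
def rateSlope (g σ2 Q : ℝ) : ℝ := g / ((1 + (g + σ2) * Q) * (1 + σ2 * Q))

section RateSlope

variable {g σ2 Q Q' : ℝ}

theorem rateSlope_nonneg (hg : 0 ≤ g) (hσ : 0 ≤ σ2) (hQ : 0 ≤ Q) : 0 ≤ rateSlope g σ2 Q := by
  unfold rateSlope
  positivity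

theorem rateSlope_le (hg : 0 ≤ g) (hσ : 0 ≤ σ2) (hQ : 0 ≤ Q) : rateSlope g σ2 Q ≤ g := by
  refine div_le_self hg ?_
  have h1 : 0 ≤ (g + σ2) * Q := by positivity
  have h2 : 0 ≤ σ2 * Q := by positivity
  nlinarith

theorem rateSlope_zero : rateSlope g σ2 0 = g := by simp [rateSlope]

theorem rateSlope_zero_left : rateSlope 0 σ2 Q = 0 := by simp [rateSlope]

/-- A bound free of the channel parameters: it caps the power that a given multiplier can request.
-/
theorem rateSlope_le_inv (hg : 0 ≤ g) (hσ : 0 ≤ σ2) (hQ : 0 < Q) : rateSlope g σ2 Q ≤ 1 / Q := by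
  unfold rateSlope
  rw [div_le_div_iff₀ (by positivity) hQ]
  have h2 : 0 ≤ σ2 * Q := by positivity
  have h3 : 0 ≤ g * Q := by positivity
  nlinarith [mul_nonneg h2 h2, mul_nonneg h2 h3]

theorem rateSlope_antitone (hg : 0 ≤ g) (hσ : 0 ≤ σ2) (hQ : 0 ≤ Q) (h : Q ≤ Q') :
    rateSlope g σ2 Q' ≤ rateSlope g σ2 Q := by
  have hQ' := hQ.trans h
  unfold rateSlope
  gcongr

theorem rateSlope_strictAnti (hg : 0 < g) (hσ : 0 ≤ σ2) (hQ : 0 ≤ Q) (h : Q < Q') :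
    rateSlope g σ2 Q' < rateSlope g σ2 Q := by
  have hQ' := hQ.trans h.le
  unfold rateSlope
  refine div_lt_div_of_pos_left hg (by positivity) ?_
  refine mul_lt_mul ?_ (by gcongr) (by positivity) (by positivity)
  gcongr

theorem rateSlope_eq_zero_iff (hg : 0 ≤ g) (hσ : 0 ≤ σ2) (hQ : 0 ≤ Q) :
    rateSlope g σ2 Q = 0 ↔ g = 0 := by
  have h : (1 + (g + σ2) * Q) * (1 + σ2 * Q) ≠ 0 := by positivity
  simp [rateSlope, div_eq_zero_iff, h]

theorem log_one_add_div_eq (hg : 0 ≤ g) (hσ : 0 ≤ σ2) (hQ : 0 ≤ Q) :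
    Real.log (1 + g * Q / (1 + σ2 * Q))
      = Real.log (1 + (g + σ2) * Q) - Real.log (1 + σ2 * Q) := by
  rw [← Real.log_div (by positivity) (by positivity)]
  congr 1
  field_simp
  ring

/-- The rate lies strictly below its tangents. -/
theorem log_sub_log_lt_rateSlope (hg : 0 < g) (hσ : 0 ≤ σ2) (hQ : 0 ≤ Q) (hQ' : 0 ≤ Q')
    (hne : Q' ≠ Q) :
    Real.log (1 + g * Q' / (1 + σ2 * Q')) - Real.log (1 + g * Q / (1 + σ2 * Q))
      < rateSlope g σ2 Q * (Q' - Q) := by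
  -- The logarithm of `X` is the rate difference. Strictness comes from `log X < X - 1`; the further
  -- passage to the tangent loses a nonnegative multiple of `(Q' - Q) ^ 2`.
  set X := (1 + (g + σ2) * Q') * (1 + σ2 * Q) / ((1 + σ2 * Q') * (1 + (g + σ2) * Q)) with hX
  have hX0 : 0 < X := by positivity
  have hX1 : X - 1 = g * (Q' - Q) / ((1 + σ2 * Q') * (1 + (g + σ2) * Q)) := by
    rw [hX]; field_simp; ring
  have hXne : X ≠ 1 := by
    intro h
    rw [h, sub_self] at hX1
    have hd : (1 + σ2 * Q') * (1 + (g + σ2) * Q) ≠ 0 := by positivity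
    rcases div_eq_zero_iff.1 hX1.symm with h' | h'
    · exact (mul_ne_zero hg.ne' (sub_ne_zero.2 hne)) h'
    · exact hd h'
  have hlog := Real.log_lt_sub_one_of_pos hX0 hXne
  have hlogX : Real.log X = Real.log (1 + g * Q' / (1 + σ2 * Q'))
      - Real.log (1 + g * Q / (1 + σ2 * Q)) := by
    rw [log_one_add_div_eq hg.le hσ hQ, log_one_add_div_eq hg.le hσ hQ', hX,
      Real.log_div (by positivity) (by positivity), Real.log_mul (by positivity) (by positivity),
      Real.log_mul (by positivity) (by positivity)]
    ring
  rw [← hlogX]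
  refine hlog.trans_le ?_
  have e : rateSlope g σ2 Q * (Q' - Q) - (X - 1)
      = g * σ2 * (Q' - Q) ^ 2
        / ((1 + (g + σ2) * Q) * (1 + σ2 * Q) * (1 + σ2 * Q')) := by
    rw [hX1, rateSlope]; field_simp; ring
  have : 0 ≤ g * σ2 * (Q' - Q) ^ 2
      / ((1 + (g + σ2) * Q) * (1 + σ2 * Q) * (1 + σ2 * Q')) := by positivity
  linarith

theorem log_sub_log_le_rateSlope (hg : 0 ≤ g) (hσ : 0 ≤ σ2) (hQ : 0 ≤ Q) (hQ' : 0 ≤ Q') :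
    Real.log (1 + g * Q' / (1 + σ2 * Q')) - Real.log (1 + g * Q / (1 + σ2 * Q))
      ≤ rateSlope g σ2 Q * (Q' - Q) := by
  rcases hg.eq_or_lt with rfl | hg
  · simp [rateSlope_zero_left]
  · rcases eq_or_ne Q' Q with rfl | hne
    · simp
    · exact (log_sub_log_lt_rateSlope hg hσ hQ hQ' hne).le

/-- The stationarity condition of one channel use is the quadratic waterfilling rule. -/
theorem stationary_iff_quadWater {lam : ℝ} (hl : 0 < lam) (hg : 0 ≤ g) (hσ : 0 ≤ σ2)
    (hQ : 0 ≤ Q) :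
    ((0 < Q → lam = rateSlope g σ2 Q) ∧ (Q = 0 → rateSlope g σ2 0 ≤ lam)) ↔
      ((0 < g → quadWater Q g σ2 = max (1 / lam - 1 / g) 0) ∧ (g = 0 → Q = 0)) := by
  rcases hg.eq_or_lt with rfl | hg
  · simp only [rateSlope_zero_left, lt_self_iff_false, false_imp_iff, true_and, forall_const]
    refine ⟨fun h => ?_, fun h => ?_⟩
    · by_contra hne
      exact hl.ne' (h.1 (lt_of_le_of_ne hQ (Ne.symm hne)))
    · exact ⟨fun h' => absurd h h'.ne', fun _ => hl.le⟩
  · simp only [hg, hg.ne', forall_const, false_imp_iff, and_true]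
    rcases hQ.eq_or_lt with rfl | hQ
    · have e : quadWater 0 g σ2 = 0 := by simp [quadWater]
      simp only [lt_self_iff_false, false_imp_iff, true_and, forall_const, rateSlope_zero, e,
        eq_comm (a := (0 : ℝ)), max_eq_right_iff, sub_nonpos]
      exact (one_div_le_one_div hl hg).symm
    · have hpos : 0 < quadWater Q g σ2 := by unfold quadWater; positivity
      -- The quadratic is the reciprocal of the slope minus `1 / g`, so equating the slope with
      -- `lam` is the waterfilling equation.
      have e : quadWater Q g σ2 = (1 + (g + σ2) * Q) * (1 + σ2 * Q) / g - 1 / g := by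
        unfold quadWater; field_simp; ring
      simp only [hQ, hQ.ne', forall_const, false_imp_iff, and_true]
      constructor
      · intro h
        have : 1 / lam = (1 + (g + σ2) * Q) * (1 + σ2 * Q) / g := by
          rw [h, rateSlope, one_div_div]
        rw [this, ← e, max_eq_left hpos.le]
      · intro h
        rcases max_choice (1 / lam - 1 / g) 0 with h' | h'
        · rw [h', e, sub_left_inj] at h
          rw [rateSlope, ← one_div_div, h, one_div_one_div]
        · rw [h'] at h
          exact absurd h hpos.ne'

end RateSlope

/-! ### Marginal rates conditioned on the CSIT -/

namespace FadingChannel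

variable {R T : Type*} [MeasurableSpace R] [MeasurableSpace T]

instance (c : FadingChannel R T) : IsProbabilityMeasure c.lawT :=
  Measure.isProbabilityMeasure_map c.measurable_csit.aemeasurable

variable {c : FadingChannel R T} {p q : T → ℝ}

/-- The derivative of the rate at the CSIR `s` and the power `Q`. -/
def slopeAt (c : FadingChannel R T) (Q : ℝ) (s : R) : ℝ := rateSlope (c.gain s) (c.variance s) Q

theorem measurable_slopeAt : Measurable fun x : ℝ × R => c.slopeAt x.1 x.2 := by
  unfold slopeAt rateSlope
  fun_prop

theorem slopeAt_nonneg {Q : ℝ} (hQ : 0 ≤ Q) (s : R) : 0 ≤ c.slopeAt Q s :=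
  rateSlope_nonneg (c.gain_nonneg s) (c.variance_nonneg s) hQ

theorem norm_slopeAt_le {Q : ℝ} (hQ : 0 ≤ Q) (s : R) : ‖c.slopeAt Q s‖ ≤ c.gain s := by
  rw [Real.norm_of_nonneg (slopeAt_nonneg hQ s)]
  exact rateSlope_le (c.gain_nonneg s) (c.variance_nonneg s) hQ

/-- The distance of the rate of `q` from the tangent at `p`. -/
def tangentGap (c : FadingChannel R T) (p q : T → ℝ) (s : R) : ℝ :=
  c.slopeAt (p (c.csit s)) s * (q (c.csit s) - p (c.csit s)) - (c.rateAt q s - c.rateAt p s)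

theorem IsPolicy.tangentGap_nonneg (hp : c.IsPolicy p) (hq : c.IsPolicy q) :
    0 ≤ c.tangentGap p q := fun s =>
  sub_nonneg.2 (log_sub_log_le_rateSlope (c.gain_nonneg s) (c.variance_nonneg s)
    (hp.nonneg _) (hq.nonneg _))

theorem rate_eq_zero (hg : ∀ᵐ s ∂c.lawR, c.gain s = 0) (p : T → ℝ) : c.rate p = 0 := by
  refine integral_eq_zero_of_ae ?_
  filter_upwards [hg] with s hs
  simp [rateAt, hs]

variable [StandardBorelSpace R] [Nonempty R]

/-- The conditional law of the CSIR given the CSIT. -/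
def condR (c : FadingChannel R T) : Kernel T R := condDistrib id c.csit c.lawR

instance (c : FadingChannel R T) : IsMarkovKernel c.condR :=
  inferInstanceAs (IsMarkovKernel (condDistrib id c.csit c.lawR))

/-- Disintegration of the law of `S_R` along the CSIT map; it turns statements over `R` into
statements on fibres over `T`. -/
theorem measurePreserving_csit_id (c : FadingChannel R T) :
    MeasurePreserving (fun s => (c.csit s, s)) c.lawR (c.lawT ⊗ₘ c.condR) :=
  ⟨c.measurable_csit.prodMk measurable_id,
    (compProd_map_condDistrib (X := c.csit) (Y := id) (μ := c.lawR)
      measurable_id.aemeasurable).symm⟩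

theorem marginalRate_eq (t : T) (Q : ℝ) : c.marginalRate t Q = ∫ s, c.slopeAt Q s ∂(c.condR t) :=
  rfl

theorem marginalRate_nonneg {Q : ℝ} (hQ : 0 ≤ Q) (t : T) : 0 ≤ c.marginalRate t Q :=
  integral_nonneg fun s => slopeAt_nonneg hQ s

theorem measurable_marginalRate (hp : Measurable p) :
    Measurable fun t => c.marginalRate t (p t) := by
  have : StronglyMeasurable fun t => ∫ s, c.slopeAt (p t) s ∂(c.condR t) :=
    StronglyMeasurable.integral_kernel_prod_right' (κ := c.condR)
      (f := fun x : T × R => c.slopeAt (p x.1) x.2)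
      (measurable_slopeAt.comp (f := fun x : T × R => (p x.1, x.2))
        (by fun_prop)).stronglyMeasurable
  exact this.measurable

theorem integrable_gain_compProd : Integrable (fun x : T × R => c.gain x.2) (c.lawT ⊗ₘ c.condR) :=
  (c.measurePreserving_csit_id.integrable_comp (Measurable.aestronglyMeasurable
    (by fun_prop))).1 c.integrable_gain

theorem ae_integrable_gain_condR : ∀ᵐ t ∂c.lawT, Integrable c.gain (c.condR t) :=
  integrable_gain_compProd.ae_of_compProd

theorem measurableSet_integrable_gain : MeasurableSet {t | Integrable c.gain (c.condR t)} :=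
  measurableSet_kernel_integrable (κ := c.condR) (f := fun _ s => c.gain s)
    (Measurable.stronglyMeasurable (by fun_prop))

theorem ae_lawR_iff {S : T → R → Prop} (hS : MeasurableSet {x : T × R | S x.1 x.2}) :
    (∀ᵐ s ∂c.lawR, S (c.csit s) s) ↔ ∀ᵐ t ∂c.lawT, ∀ᵐ s ∂(c.condR t), S t s := by
  rw [← Measure.ae_compProd_iff hS, ← c.measurePreserving_csit_id.map_eq,
    ae_map_iff c.measurePreserving_csit_id.measurable.aemeasurable hS]

theorem ae_gain_eq_zero_iff :
    (∀ᵐ s ∂c.lawR, c.gain s = 0) ↔ ∀ᵐ t ∂c.lawT, ∀ᵐ s ∂(c.condR t), c.gain s = 0 :=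
  ae_lawR_iff (S := fun _ s => c.gain s = 0)
    (measurableSet_eq_fun (by fun_prop) measurable_const)

section Fiber

variable {t : T} {Q Q' : ℝ}

theorem integrable_slopeAt (ht : Integrable c.gain (c.condR t)) (hQ : 0 ≤ Q) :
    Integrable (c.slopeAt Q) (c.condR t) := by
  refine ht.mono' (measurable_slopeAt.comp measurable_prodMk_left).aestronglyMeasurable
    (ae_of_all _ fun s => norm_slopeAt_le hQ s)

theorem marginalRate_eq_zero_iff (ht : Integrable c.gain (c.condR t)) (hQ : 0 ≤ Q) :
    c.marginalRate t Q = 0 ↔ ∀ᵐ s ∂(c.condR t), c.gain s = 0 := by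
  rw [marginalRate_eq, integral_eq_zero_iff_of_nonneg (slopeAt_nonneg hQ)
    (integrable_slopeAt ht hQ)]
  refine eventually_congr (ae_of_all _ fun s => ?_)
  exact rateSlope_eq_zero_iff (c.gain_nonneg s) (c.variance_nonneg s) hQ

theorem marginalRate_antitone (ht : Integrable c.gain (c.condR t)) (hQ : 0 ≤ Q) (h : Q ≤ Q') :
    c.marginalRate t Q' ≤ c.marginalRate t Q :=
  integral_mono (integrable_slopeAt ht (hQ.trans h)) (integrable_slopeAt ht hQ)
    fun s => rateSlope_antitone (c.gain_nonneg s) (c.variance_nonneg s) hQ h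

/-- The slopes are ordered pointwise, so equal integrals force equal slopes almost everywhere on the
fibre. That is possible only where the gain is zero, and then the marginal rate vanishes. -/
theorem marginalRate_strictAnti (ht : Integrable c.gain (c.condR t)) (hQ : 0 ≤ Q) (h : Q < Q')
    (h0 : c.marginalRate t Q ≠ 0) : c.marginalRate t Q' < c.marginalRate t Q := by
  refine lt_of_le_of_ne (marginalRate_antitone ht hQ h.le) fun he => h0 ?_
  have i1 := integrable_slopeAt ht hQ
  have i2 := integrable_slopeAt ht (hQ.trans h.le)
  have hz : ∫ s, (c.slopeAt Q s - c.slopeAt Q' s) ∂(c.condR t) = 0 := by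
    rw [integral_sub i1 i2, ← marginalRate_eq, ← marginalRate_eq, he, sub_self]
  have hnn : 0 ≤ fun s => c.slopeAt Q s - c.slopeAt Q' s := fun s => sub_nonneg.2
    (rateSlope_antitone (c.gain_nonneg s) (c.variance_nonneg s) hQ h.le)
  rw [integral_eq_zero_iff_of_nonneg hnn (i1.sub i2)] at hz
  rw [marginalRate_eq_zero_iff ht hQ]
  filter_upwards [hz] with s hs
  by_contra hg
  have := rateSlope_strictAnti (lt_of_le_of_ne (c.gain_nonneg s) (Ne.symm hg))
    (c.variance_nonneg s) hQ h
  exact this.ne (sub_eq_zero.1 hs).symm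

theorem marginalRate_le_inv (ht : Integrable c.gain (c.condR t)) (hQ : 0 < Q) :
    c.marginalRate t Q ≤ 1 / Q := by
  refine (integral_mono (integrable_slopeAt ht hQ.le) (integrable_const (1 / Q))
    fun s => rateSlope_le_inv (c.gain_nonneg s) (c.variance_nonneg s) hQ).trans_eq ?_
  simp

theorem continuousOn_marginalRate (ht : Integrable c.gain (c.condR t)) :
    ContinuousOn (c.marginalRate t) (Set.Ici 0) := by
  refine continuousOn_of_dominated (bound := c.gain)
    (fun Q _ => (measurable_slopeAt.comp measurable_prodMk_left).aestronglyMeasurable)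
    (fun Q hQ => ae_of_all _ fun s => norm_slopeAt_le hQ s) ht (ae_of_all _ fun s Q hQ => ?_)
  have h1 := c.gain_nonneg s
  have h2 := c.variance_nonneg s
  have h3 : 0 ≤ Q := hQ
  refine ContinuousAt.continuousWithinAt (ContinuousAt.div (by fun_prop) (by fun_prop) ?_)
  positivity

end Fiber

/-! ### The Karush-Kuhn-Tucker conditions -/

/-- The Karush-Kuhn-Tucker conditions with the multiplier `lam`. -/
def IsStationary (c : FadingChannel R T) (p : T → ℝ) (lam : ℝ) : Prop :=
  ∀ᵐ t ∂c.lawT, (0 < p t → lam = c.marginalRate t (p t)) ∧ (p t = 0 → c.marginalRate t 0 ≤ lam)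

theorem IsStationary.marginalRate_le {lam : ℝ} (h : c.IsStationary p lam) (hp : ∀ t, 0 ≤ p t) :
    ∀ᵐ t ∂c.lawT, c.marginalRate t (p t) ≤ lam := by
  filter_upwards [h] with t ht
  rcases (hp t).eq_or_lt with h0 | h0
  · rw [← h0]; exact ht.2 h0.symm
  · exact (ht.1 h0).ge

/-- The slope is bounded only by the gain, so its product with a power is not integrable for free.
The uniform bound `lam` on its fibre means gives integrability of the product. -/
theorem IsPolicy.integral_slopeAt_mul (hp : c.IsPolicy p) (hq : c.IsPolicy q) {lam : ℝ}
    (h : ∀ᵐ t ∂c.lawT, c.marginalRate t (p t) ≤ lam) :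
    Integrable (fun t => c.marginalRate t (p t) * q t) c.lawT ∧
    Integrable (fun s => c.slopeAt (p (c.csit s)) s * q (c.csit s)) c.lawR ∧
    ∫ s, c.slopeAt (p (c.csit s)) s * q (c.csit s) ∂c.lawR
      = ∫ t, c.marginalRate t (p t) * q t ∂c.lawT := by
  have hp1 := hp.measurable
  have hq1 := hq.measurable
  have i1 : Integrable (fun t => c.marginalRate t (p t) * q t) c.lawT := by
    refine (hq.integrable.const_mul lam).mono'
      ((measurable_marginalRate hp1).mul hq1).aestronglyMeasurable ?_
    filter_upwards [h] with t ht
    rw [Real.norm_of_nonneg (mul_nonneg (marginalRate_nonneg (hp.nonneg t) t) (hq.nonneg t))]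
    exact mul_le_mul_of_nonneg_right ht (hq.nonneg t)
  have m1 : Measurable fun x : T × R => c.slopeAt (p x.1) x.2 * q x.1 :=
    (measurable_slopeAt.comp (f := fun x : T × R => (p x.1, x.2)) (by fun_prop)).mul
      (by fun_prop)
  have i2 : Integrable (fun x : T × R => c.slopeAt (p x.1) x.2 * q x.1) (c.lawT ⊗ₘ c.condR) := by
    refine (Measure.integrable_compProd_iff m1.aestronglyMeasurable).2 ⟨?_, i1.congr ?_⟩
    · filter_upwards [c.ae_integrable_gain_condR] with t ht
      exact (integrable_slopeAt ht (hp.nonneg t)).mul_const _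
    · refine ae_of_all _ fun t => ?_
      have : ∀ s, ‖c.slopeAt (p t) s * q t‖ = c.slopeAt (p t) s * q t := fun s =>
        Real.norm_of_nonneg (mul_nonneg (slopeAt_nonneg (hp.nonneg t) s) (hq.nonneg t))
      simp_rw [this]
      rw [integral_mul_const, marginalRate_eq]
  refine ⟨i1, c.measurePreserving_csit_id.integrable_comp_of_integrable i2, ?_⟩
  have e := integral_map (μ := c.lawR) c.measurePreserving_csit_id.measurable.aemeasurable
    (f := fun x : T × R => c.slopeAt (p x.1) x.2 * q x.1) m1.aestronglyMeasurable
  rw [← e, c.measurePreserving_csit_id.map_eq, Measure.integral_compProd i2]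
  simp_rw [integral_mul_const]
  rfl

/-- The gap between the rate of a stationary policy and the rate of another policy. -/
theorem IsPolicy.rate_sub_rate (hp : c.IsPolicy p) (hq : c.IsPolicy q) {lam : ℝ}
    (h : c.IsStationary p lam) :
    Integrable (c.tangentGap p q) c.lawR ∧
    Integrable (fun t => (lam - c.marginalRate t (p t)) * q t) c.lawT ∧
    c.rate p - c.rate q
      = ∫ s, c.tangentGap p q s ∂c.lawR
        + ∫ t, (lam - c.marginalRate t (p t)) * q t ∂c.lawT
        + lam * (c.meanPower p - c.meanPower q) := by
  have hle := h.marginalRate_le hp.nonneg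
  obtain ⟨a1, a2, a3⟩ := hp.integral_slopeAt_mul hp hle
  obtain ⟨b1, b2, b3⟩ := hp.integral_slopeAt_mul hq hle
  -- Complementary slackness: the marginal rate equals `lam` wherever power is spent.
  have hpp : ∫ t, c.marginalRate t (p t) * p t ∂c.lawT = lam * c.meanPower p := by
    rw [meanPower, ← integral_const_mul]
    refine integral_congr_ae ?_
    filter_upwards [h] with t ht
    rcases (hp.nonneg t).eq_or_lt with h0 | h0
    · rw [← h0, mul_zero, mul_zero]
    · rw [← ht.1 h0]
  have i1 := hp.integrable_rateAt
  have i2 := hq.integrable_rateAt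
  have i3 := hq.integrable.const_mul lam
  have e1 : c.tangentGap p q = fun s => (c.slopeAt (p (c.csit s)) s * q (c.csit s)
      - c.slopeAt (p (c.csit s)) s * p (c.csit s)) - (c.rateAt q s - c.rateAt p s) := by
    funext s; rw [tangentGap]; ring
  have e2 : (fun t => (lam - c.marginalRate t (p t)) * q t)
      = fun t => lam * q t - c.marginalRate t (p t) * q t := by
    funext t; ring
  have i4 : Integrable (fun s => c.slopeAt (p (c.csit s)) s * q (c.csit s)
      - c.slopeAt (p (c.csit s)) s * p (c.csit s)) c.lawR := b2.sub a2
  have i5 : Integrable (fun s => c.rateAt q s - c.rateAt p s) c.lawR := i2.sub i1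
  rw [e1, e2]
  refine ⟨i4.sub i5, i3.sub b1, ?_⟩
  rw [integral_sub i4 i5, integral_sub b2 a2, integral_sub i2 i1,
    integral_sub i3 b1, a3, b3, hpp, integral_const_mul]
  simp only [rate, meanPower]
  ring

theorem IsPolicy.multiplier_gap_nonneg (hp : c.IsPolicy p) (hq : c.IsPolicy q) {lam : ℝ}
    (h : c.IsStationary p lam) :
    0 ≤ᵐ[c.lawT] fun t => (lam - c.marginalRate t (p t)) * q t := by
  filter_upwards [h.marginalRate_le hp.nonneg] with t ht
  exact mul_nonneg (sub_nonneg.2 ht) (hq.nonneg t)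

theorem IsStationary.isOptimal {lam P : ℝ} (h : c.IsStationary p lam) (hp : c.IsPolicy p)
    (hl : 0 ≤ lam) (hP : c.meanPower p = P) : c.IsOptimal P p := by
  refine ⟨hp, hP, fun q hq hqP => ?_⟩
  obtain ⟨-, -, e⟩ := hp.rate_sub_rate hq h
  have h1 := integral_nonneg (μ := c.lawR) (hp.tangentGap_nonneg hq)
  have h2 := integral_nonneg_of_ae (hp.multiplier_gap_nonneg hq h)
  have h3 : 0 ≤ lam * (c.meanPower p - c.meanPower q) :=
    mul_nonneg hl (by rw [hP]; exact sub_nonneg.2 hqP)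
  linarith

/-- A stationary policy with a positive multiplier is the only optimal policy. -/
theorem IsStationary.ae_eq {lam : ℝ} (h : c.IsStationary p lam) (hp : c.IsPolicy p)
    (hq : c.IsPolicy q) (hl : 0 < lam) (hm : c.meanPower q ≤ c.meanPower p)
    (hr : c.rate p ≤ c.rate q) : q =ᵐ[c.lawT] p := by
  obtain ⟨i1, i2, e⟩ := hp.rate_sub_rate hq h
  have h1 := integral_nonneg (μ := c.lawR) (hp.tangentGap_nonneg hq)
  have h2 := integral_nonneg_of_ae (hp.multiplier_gap_nonneg hq h)
  have h3 : 0 ≤ lam * (c.meanPower p - c.meanPower q) := mul_nonneg hl.le (sub_nonneg.2 hm)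
  -- The rate difference is nonpositive yet a sum of three nonnegative terms, so each vanishes.
  have z1 := (integral_eq_zero_iff_of_nonneg (hp.tangentGap_nonneg hq) i1).1 (by linarith)
  have z2 := (integral_eq_zero_iff_of_nonneg_ae (hp.multiplier_gap_nonneg hq h) i2).1
    (by linarith)
  have hp1 := hp.measurable
  have hq1 := hq.measurable
  have z3 : ∀ᵐ s ∂c.lawR, c.gain s = 0 ∨ q (c.csit s) = p (c.csit s) := by
    filter_upwards [z1] with s hs
    by_contra! hne
    have := log_sub_log_lt_rateSlope (lt_of_le_of_ne (c.gain_nonneg s) (Ne.symm hne.1))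
      (c.variance_nonneg s) (hp.nonneg (c.csit s)) (hq.nonneg (c.csit s)) hne.2
    exact this.ne' (sub_eq_zero.1 hs)
  rw [ae_lawR_iff (S := fun t s => c.gain s = 0 ∨ q t = p t)
    ((measurableSet_eq_fun (by fun_prop) measurable_const).union
      (measurableSet_eq_fun (by fun_prop) (by fun_prop)))] at z3
  filter_upwards [z2, z3, h, c.ae_integrable_gain_condR] with t ht2 ht3 ht hti
  by_contra hne
  -- A fibre where the policies differ has no gain, hence zero marginal rate. As `lam` is positive,
  -- stationarity makes `p t` zero and the multiplier gap makes `q t` zero.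
  have hg : ∀ᵐ s ∂(c.condR t), c.gain s = 0 := by
    filter_upwards [ht3] with s hs
    exact hs.resolve_right hne
  have hz : ∀ {Q : ℝ}, 0 ≤ Q → c.marginalRate t Q = 0 := fun hQ =>
    (marginalRate_eq_zero_iff hti hQ).2 hg
  have hp0 : p t = 0 := by
    by_contra hp0
    have := ht.1 (lt_of_le_of_ne (hp.nonneg t) (Ne.symm hp0))
    rw [hz (hp.nonneg t)] at this
    exact hl.ne' this
  rw [hz (hp.nonneg t), sub_zero] at ht2
  have hq0 : q t = 0 := (mul_eq_zero.1 ht2).resolve_left hl.ne'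
  exact hne (hq0.trans hp0.symm)

end FadingChannel

namespace FadingChannel

variable {R T : Type*} [MeasurableSpace R] [MeasurableSpace T]
  [StandardBorelSpace R] [Nonempty R] {c : FadingChannel R T} {p q : T → ℝ}

/-! ### The waterfilling policy of a given multiplier -/

open Classical in
/-- The power whose marginal rate is `lam`, or zero if there is none. -/
def level (c : FadingChannel R T) (lam : ℝ) (t : T) : ℝ :=
  if h : Integrable c.gain (c.condR t) ∧ ∃ Q, 0 < Q ∧ c.marginalRate t Q = lam
  then h.2.choose else 0

theorem level_nonneg (lam : ℝ) (t : T) : 0 ≤ c.level lam t := by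
  unfold level
  split_ifs with h
  · exact h.2.choose_spec.1.le
  · exact le_rfl

theorem integrable_and_marginalRate_level {lam : ℝ} {t : T} (h : 0 < c.level lam t) :
    Integrable c.gain (c.condR t) ∧ c.marginalRate t (c.level lam t) = lam := by
  unfold level at h ⊢
  split_ifs at h ⊢ with h'
  · exact ⟨h'.1, h'.2.choose_spec.2⟩
  · exact absurd h (lt_irrefl 0)

theorem level_le_inv {lam : ℝ} (hl : 0 < lam) (t : T) : c.level lam t ≤ 1 / lam := by
  rcases (level_nonneg (c := c) lam t).eq_or_lt with h | h
  · rw [← h]; positivity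
  · obtain ⟨h1, h2⟩ := integrable_and_marginalRate_level h
    have h3 := marginalRate_le_inv h1 h
    rw [h2] at h3
    rwa [le_div_iff₀ hl, mul_comm, ← le_div_iff₀ h]

section Fiber

variable {t : T}

/-- Intermediate value theorem on `[0, 1 / lam]`; at the right end the marginal rate is at most
`lam` by `marginalRate_le_inv`. -/
theorem exists_marginalRate_eq (ht : Integrable c.gain (c.condR t)) {lam : ℝ} (hl : 0 < lam)
    (h0 : lam < c.marginalRate t 0) : ∃ Q, 0 < Q ∧ c.marginalRate t Q = lam := by
  have hle : c.marginalRate t (1 / lam) ≤ lam := by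
    simpa using marginalRate_le_inv ht (one_div_pos.2 hl)
  obtain ⟨Q, hQ, hQl⟩ := intermediate_value_Icc' (one_div_pos.2 hl).le
    ((continuousOn_marginalRate ht).mono Set.Icc_subset_Ici_self) ⟨hle, h0.le⟩
  refine ⟨Q, lt_of_le_of_ne hQ.1 fun h => ?_, hQl⟩
  rw [← h] at hQl
  exact h0.ne' hQl

theorem level_pos (ht : Integrable c.gain (c.condR t)) {lam : ℝ} (hl : 0 < lam)
    (h0 : lam < c.marginalRate t 0) : 0 < c.level lam t := by
  have h : Integrable c.gain (c.condR t) ∧ ∃ Q, 0 < Q ∧ c.marginalRate t Q = lam :=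
    ⟨ht, exists_marginalRate_eq ht hl h0⟩
  rw [level, dif_pos h]
  exact h.2.choose_spec.1

/-- The level is defined by choice; this equivalence describes it through the marginal rate alone,
and both its measurability in `t` and its continuity in `lam` follow from it. -/
theorem le_level_iff (ht : Integrable c.gain (c.condR t)) {lam : ℝ} (hl : 0 < lam) {Q : ℝ}
    (hQ : 0 < Q) : Q ≤ c.level lam t ↔ lam ≤ c.marginalRate t Q := by
  constructor
  · intro h
    rw [← (integrable_and_marginalRate_level (hQ.trans_le h)).2]
    exact marginalRate_antitone ht hQ.le h
  · intro h
    have h0 : c.marginalRate t Q < c.marginalRate t 0 :=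
      marginalRate_strictAnti ht le_rfl hQ fun h' => by
        have := marginalRate_antitone ht le_rfl hQ.le
        linarith
    have hpos := level_pos ht hl (h.trans_lt h0)
    by_contra! hlt
    have h1 := (integrable_and_marginalRate_level hpos).2
    have h2 := marginalRate_strictAnti ht hpos.le hlt (by rw [h1]; exact hl.ne')
    rw [h1] at h2
    exact absurd h (not_le.2 h2)

theorem continuousOn_level (ht : Integrable c.gain (c.condR t)) :
    ContinuousOn (fun lam => c.level lam t) (Set.Ioi 0) := by
  intro lam hl
  refine ContinuousAt.continuousWithinAt ?_
  have hl' : 0 < lam := hl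
  have hpos : ∀ᶠ l in 𝓝 lam, 0 < l := lt_mem_nhds hl'
  refine tendsto_order.2 ⟨fun x hx => ?_, fun x hx => ?_⟩
  · rcases lt_or_ge x 0 with hx0 | hx0
    · exact Eventually.of_forall fun l => hx0.trans_le (level_nonneg l t)
    -- At a power strictly below the level the marginal rate strictly exceeds `lam`, hence also
    -- exceeds nearby multipliers.
    · obtain ⟨Q, hxQ, hQL⟩ := exists_between hx
      have hQ0 : 0 < Q := hx0.trans_lt hxQ
      have h1 := (le_level_iff ht hl' hQ0).1 hQL.le
      have h2 := marginalRate_strictAnti ht hQ0.le hQL (hl'.trans_le h1).ne'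
      rw [(integrable_and_marginalRate_level (hQ0.trans hQL)).2] at h2
      filter_upwards [hpos, gt_mem_nhds h2] with l hl0 hl2
      exact hxQ.trans_le ((le_level_iff ht hl0 hQ0).2 hl2.le)
  · have hx0 : 0 < x := (level_nonneg lam t).trans_lt hx
    have h1 := (le_level_iff ht hl' hx0).not.1 (not_le.2 hx)
    filter_upwards [hpos, lt_mem_nhds (not_le.1 h1)] with l hl0 hl2
    exact not_le.1 ((le_level_iff ht hl0 hx0).not.2 (not_le.2 hl2))

end Fiber

theorem measurable_level {lam : ℝ} (hl : 0 < lam) : Measurable (c.level lam) := by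
  refine measurable_of_Ici fun Q => ?_
  rcases le_or_gt Q 0 with hQ | hQ
  · convert MeasurableSet.univ
    ext t
    simpa using hQ.trans (level_nonneg lam t)
  · have : c.level lam ⁻¹' Set.Ici Q
        = {t | Integrable c.gain (c.condR t)} ∩ {t | lam ≤ c.marginalRate t Q} := by
      ext t
      simp only [Set.mem_preimage, Set.mem_Ici, Set.mem_inter_iff, Set.mem_ofPred_eq]
      constructor
      · intro h
        have ht := (integrable_and_marginalRate_level (hQ.trans_le h)).1
        exact ⟨ht, (le_level_iff ht hl hQ).1 h⟩
      · rintro ⟨ht, h⟩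
        exact (le_level_iff ht hl hQ).2 h
    rw [this]
    exact measurableSet_integrable_gain.inter
      (measurableSet_le measurable_const (measurable_marginalRate (p := fun _ => Q)
        measurable_const))

theorem isPolicy_level {lam : ℝ} (hl : 0 < lam) : c.IsPolicy (c.level lam) := by
  refine ⟨measurable_level hl, level_nonneg lam, ?_⟩
  refine (integrable_const (1 / lam)).mono' (measurable_level hl).aestronglyMeasurable
    (ae_of_all _ fun t => ?_)
  rw [Real.norm_of_nonneg (level_nonneg lam t)]
  exact level_le_inv hl t

theorem isStationary_level {lam : ℝ} (hl : 0 < lam) : c.IsStationary (c.level lam) lam := by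
  filter_upwards [c.ae_integrable_gain_condR] with t ht
  refine ⟨fun h => (integrable_and_marginalRate_level h).2.symm, fun h => ?_⟩
  by_contra! h0
  exact (level_pos ht hl h0).ne' h

/-- Dominated convergence: for multipliers above `lam / 2` all levels are at most `2 / lam`. -/
theorem continuousOn_meanPower_level :
    ContinuousOn (fun lam => c.meanPower (c.level lam)) (Set.Ioi 0) := by
  intro lam hl
  have hl' : 0 < lam := hl
  refine ContinuousAt.continuousWithinAt ?_
  have hnear : ∀ᶠ l in 𝓝 lam, lam / 2 < l := lt_mem_nhds (half_lt_self hl')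
  refine tendsto_integral_filter_of_dominated_convergence (fun _ => 1 / (lam / 2)) ?_ ?_
    (integrable_const _) ?_
  · filter_upwards [hnear] with l h
    exact (measurable_level ((half_pos hl').trans h)).aestronglyMeasurable
  · filter_upwards [hnear] with l h
    refine ae_of_all _ fun t => ?_
    rw [Real.norm_of_nonneg (level_nonneg l t)]
    exact (level_le_inv ((half_pos hl').trans h) t).trans
      (one_div_le_one_div_of_le (half_pos hl') h.le)
  · filter_upwards [c.ae_integrable_gain_condR] with t ht
    exact (continuousOn_level ht).continuousAt (Ioi_mem_nhds hl')

theorem meanPower_level_le {lam : ℝ} (hl : 0 < lam) : c.meanPower (c.level lam) ≤ 1 / lam := by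
  refine (integral_mono (isPolicy_level hl).integrable (integrable_const (1 / lam))
    fun t => level_le_inv hl t).trans_eq ?_
  simp

/-- Small multipliers use much power. -/
theorem exists_le_meanPower_level (hg : ¬ ∀ᵐ s ∂c.lawR, c.gain s = 0) (P : ℝ) :
    ∃ lam, 0 < lam ∧ P ≤ c.meanPower (c.level lam) := by
  rw [ae_gain_eq_zero_iff] at hg
  set B := {t | Integrable c.gain (c.condR t) ∧ 0 < c.marginalRate t 0} with hB
  have hB0 : c.lawT B ≠ 0 := by
    intro h
    refine hg ?_
    filter_upwards [measure_eq_zero_iff_ae_notMem.1 h, c.ae_integrable_gain_condR] with t h1 h2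
    rw [← marginalRate_eq_zero_iff h2 le_rfl]
    by_contra hne
    exact h1 ⟨h2, lt_of_le_of_ne (marginalRate_nonneg le_rfl t) (Ne.symm hne)⟩
  have hβ : 0 < c.lawT.real B := ENNReal.toReal_pos hB0 (measure_ne_top _ _)
  -- Power `Q` spent on more than half of `B`, the CSIT with usable gain, already costs at least
  -- `P`.
  obtain ⟨Q, hQ, hQP⟩ : ∃ Q : ℝ, 0 < Q ∧ 2 * P ≤ Q * c.lawT.real B := by
    refine ⟨max 1 (2 * P / c.lawT.real B), by positivity, ?_⟩
    rw [← div_le_iff₀ hβ]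
    exact le_max_right _ _
  set S : ℕ → Set T := fun k => {t | Integrable c.gain (c.condR t)} ∩
    {t | 1 / ((k : ℝ) + 1) ≤ c.marginalRate t Q} with hS
  have hSm : ∀ k, MeasurableSet (S k) := fun k =>
    measurableSet_integrable_gain.inter (measurableSet_le measurable_const
      (measurable_marginalRate (p := fun _ => Q) measurable_const))
  have hmono : Monotone S := fun k l hkl t ht =>
    ⟨ht.1, Set.mem_ofPred_eq.mpr ((Nat.one_div_le_one_div hkl).trans ht.2)⟩
  -- Usable gain keeps the marginal rate positive at `Q`, so a small enough multiplier sets the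
  -- level to at least `Q`; continuity of measure then picks one `k` for more than half of `B`.
  have hBS : B ⊆ ⋃ k, S k := by
    intro t ht
    obtain ⟨h1, h2⟩ : Integrable c.gain (c.condR t) ∧ 0 < c.marginalRate t 0 := ht
    have h3 : 0 < c.marginalRate t Q := by
      refine lt_of_le_of_ne (marginalRate_nonneg hQ.le t) (Ne.symm fun h => h2.ne' ?_)
      rw [marginalRate_eq_zero_iff h1 le_rfl, ← marginalRate_eq_zero_iff h1 hQ.le, h]
    obtain ⟨k, hk⟩ := exists_nat_one_div_lt h3
    exact Set.mem_iUnion.2 ⟨k, h1, hk.le⟩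
  have hlim := tendsto_measure_iUnion_atTop (μ := c.lawT) hmono
  have hlim' : Tendsto (fun k => c.lawT.real (S k)) atTop (𝓝 (c.lawT.real (⋃ k, S k))) :=
    (ENNReal.tendsto_toReal (measure_ne_top _ _)).comp hlim
  have hlt : c.lawT.real B / 2 < c.lawT.real (⋃ k, S k) :=
    (half_lt_self hβ).trans_le (measureReal_mono hBS)
  obtain ⟨k, hk⟩ := (hlim'.eventually_const_lt hlt).exists
  have hl : (0 : ℝ) < 1 / ((k : ℝ) + 1) := by positivity
  refine ⟨1 / ((k : ℝ) + 1), hl, ?_⟩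
  have hind : ∫ t, (S k).indicator (fun _ => Q) t ∂c.lawT = c.lawT.real (S k) * Q := by
    rw [integral_indicator_const _ (hSm k), smul_eq_mul]
  have hle : c.lawT.real (S k) * Q ≤ c.meanPower (c.level (1 / ((k : ℝ) + 1))) := by
    rw [← hind]
    refine integral_mono ((integrable_const Q).indicator (hSm k))
      (isPolicy_level hl).integrable fun t => ?_
    by_cases ht : t ∈ S k
    · rw [Set.indicator_of_mem ht]
      exact (le_level_iff ht.1 hl hQ).2 ht.2
    · rw [Set.indicator_of_notMem ht]
      exact level_nonneg _ t
  nlinarith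

/-- Some multiplier spends exactly the power `P`. -/
theorem exists_meanPower_level_eq (hg : ¬ ∀ᵐ s ∂c.lawR, c.gain s = 0) {P : ℝ} (hP : 0 < P) :
    ∃ lam, 0 < lam ∧ c.meanPower (c.level lam) = P := by
  obtain ⟨l, hl, hlP⟩ := exists_le_meanPower_level hg P
  have h2 : c.meanPower (c.level (1 / P)) ≤ P := by
    simpa using meanPower_level_le (c := c) (one_div_pos.2 hP)
  obtain ⟨lam, h, e⟩ := isPreconnected_Ioi.intermediate_value (a := 1 / P) (b := l)
    (Set.mem_Ioi.2 (one_div_pos.2 hP)) (Set.mem_Ioi.2 hl) continuousOn_meanPower_level ⟨h2, hlP⟩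
  exact ⟨lam, h, e⟩

theorem isStationary_zero (hg : ∀ᵐ s ∂c.lawR, c.gain s = 0) (hp : ∀ t, 0 ≤ p t) :
    c.IsStationary p 0 := by
  rw [ae_gain_eq_zero_iff] at hg
  filter_upwards [hg, c.ae_integrable_gain_condR] with t h1 h2
  have hz : ∀ {Q : ℝ}, 0 ≤ Q → c.marginalRate t Q = 0 := fun hQ =>
    (marginalRate_eq_zero_iff h2 hQ).2 h1
  exact ⟨fun _ => (hz (hp t)).symm, fun _ => (hz le_rfl).le⟩

theorem IsStationary.congr {lam : ℝ} (h : c.IsStationary p lam) (hqp : q =ᵐ[c.lawT] p) :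
    c.IsStationary q lam := by
  filter_upwards [h, hqp] with t ht he
  rwa [he]

/-- With a zero multiplier the marginal rate at `p` would vanish on almost every fibre, and hence so
would the gain. -/
theorem IsStationary.multiplier_pos {lam : ℝ} (h : c.IsStationary p lam) (hp : ∀ t, 0 ≤ p t)
    (hl : 0 ≤ lam) (hg : ¬ ∀ᵐ s ∂c.lawR, c.gain s = 0) : 0 < lam := by
  refine lt_of_le_of_ne hl fun h0 => hg ?_
  rw [ae_gain_eq_zero_iff]
  filter_upwards [h.marginalRate_le hp, c.ae_integrable_gain_condR] with t h1 h2
  rw [← marginalRate_eq_zero_iff h2 (hp t)]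
  exact le_antisymm (h1.trans h0.ge) (marginalRate_nonneg (hp t) t)

theorem exists_isOptimal (c : FadingChannel R T) {P : ℝ} (hP : 0 < P) :
    ∃ p : T → ℝ, c.IsOptimal P p := by
  by_cases hg : ∀ᵐ s ∂c.lawR, c.gain s = 0
  · refine ⟨fun _ => P, ⟨measurable_const, fun _ => hP.le, integrable_const _⟩, ?_, fun q _ _ => ?_⟩
    · simp [meanPower]
    · rw [rate_eq_zero hg, rate_eq_zero hg]
  · obtain ⟨lam, hl, e⟩ := exists_meanPower_level_eq hg hP
    exact ⟨_, (isStationary_level hl).isOptimal (isPolicy_level hl) hl.le e⟩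

/-- For necessity, an optimal `p` does at least as well as the level policy of mean power `P`. That
policy is stationary with a positive multiplier, so `p` agrees with it almost everywhere. -/
theorem IsPolicy.isOptimal_iff (hp : c.IsPolicy p) {P : ℝ} (hP : 0 < P) (hm : c.meanPower p = P) :
    c.IsOptimal P p ↔ ∃ lam : ℝ, 0 ≤ lam ∧ c.IsStationary p lam := by
  refine ⟨fun h => ?_, fun ⟨lam, hl, h⟩ => h.isOptimal hp hl hm⟩
  by_cases hg : ∀ᵐ s ∂c.lawR, c.gain s = 0
  · exact ⟨0, le_rfl, isStationary_zero hg hp.nonneg⟩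
  · obtain ⟨lam, hl, e⟩ := exists_meanPower_level_eq hg hP
    have hs := isStationary_level (c := c) hl
    have hq := isPolicy_level (c := c) hl
    exact ⟨lam, hl.le, hs.congr (hs.ae_eq hq hp hl (by rw [hm, e]) (h.2.2 _ hq e.le))⟩

/-- If the transmitter knows the CSIR then the stationarity conditions are quadratic
waterfilling. -/
theorem IsPolicy.isStationary_iff_quadWater (hp : c.IsPolicy p) (hd : c.Determines) {lam : ℝ}
    (hl : 0 < lam) :
    c.IsStationary p lam ↔ ∀ᵐ s ∂c.lawR,
      (0 < c.gain s → quadWater (p (c.csit s)) (c.gain s) (c.variance s)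
        = max (1 / lam - 1 / c.gain s) 0) ∧
      (c.gain s = 0 → p (c.csit s) = 0) := by
  have hp1 := hp.measurable
  obtain ⟨g, hgm, hg⟩ := hd
  have hg' := (ae_lawR_iff (c := c) (S := fun t s => g t = s)
    (measurableSet_eq_fun (hgm.comp measurable_fst) measurable_snd)).1 hg
  -- The conditional law is concentrated at `g t`, so the marginal rate is a point evaluation for
  -- all powers at once.
  have e : ∀ᵐ t ∂c.lawT, ∀ Q, c.marginalRate t Q = c.slopeAt Q (g t) := by
    filter_upwards [hg'] with t ht Q
    rw [marginalRate_eq]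
    have : ∀ᵐ s ∂(c.condR t), c.slopeAt Q s = c.slopeAt Q (g t) := by
      filter_upwards [ht] with s hs
      rw [hs]
    rw [integral_congr_ae this]
    simp
  have hS : MeasurableSet {t : T |
      (0 < p t → lam = c.marginalRate t (p t)) ∧ (p t = 0 → c.marginalRate t 0 ≤ lam)} := by
    have m1 := measurable_marginalRate (c := c) hp1
    have m2 := measurable_marginalRate (c := c) (p := fun _ => 0) measurable_const
    exact ((measurableSet_lt measurable_const hp1).imp
      (measurableSet_eq_fun measurable_const m1)).inter
        ((measurableSet_eq_fun hp1 measurable_const).imp (measurableSet_le m2 measurable_const))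
  rw [IsStationary, lawT, ae_map_iff c.measurable_csit.aemeasurable hS]
  refine eventually_congr ?_
  filter_upwards [hg, ae_of_ae_map c.measurable_csit.aemeasurable e] with s hs he
  rw [he, he, hs]
  exact stationary_iff_quadWater hl (c.gain_nonneg s) (c.variance_nonneg s) (hp.nonneg _)

end FadingChannel

end

/-! ### Assembly of the three claims -/

theorem mainTheorem6 {R T : Type*} [MeasurableSpace R] [StandardBorelSpace R] [Nonempty R]
    [MeasurableSpace T] (c : FadingChannel R T) (P : ℝ) :
    -- the rate is the maximum forward model GMI and it is achievable
    (∀ p : T → ℝ, c.IsPolicy p → c.meanPower p = P →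
      Integrable (c.rateAt p) c.lawR ∧
      IsGreatest (c.forwardGMIs p) (c.rate p) ∧
      c.Achievable P (c.rate p)) ∧
    -- the optimal powers
    (0 < P →
      (∃ p : T → ℝ, c.IsOptimal P p) ∧
      ∀ p : T → ℝ, c.IsPolicy p → c.meanPower p = P →
        (c.IsOptimal P p ↔ ∃ lam : ℝ, 0 ≤ lam ∧ ∀ᵐ t ∂c.lawT,
          (0 < p t → lam = c.marginalRate t (p t)) ∧
          (p t = 0 → c.marginalRate t 0 ≤ lam))) ∧
    -- quadratic waterfilling
    (0 < P → c.Determines → ¬ (∀ᵐ s ∂c.lawR, c.gain s = 0) →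
      ∀ p : T → ℝ, c.IsPolicy p → c.meanPower p = P →
        (c.IsOptimal P p ↔ ∃ lam : ℝ, 0 < lam ∧ ∀ᵐ s ∂c.lawR,
          (0 < c.gain s →
            quadWater (p (c.csit s)) (c.gain s) (c.variance s)
              = max (1 / lam - 1 / c.gain s) 0) ∧
          (c.gain s = 0 → p (c.csit s) = 0))) := by
  refine ⟨fun p hp hm => ⟨hp.integrable_rateAt, hp.isGreatest_forwardGMIs, hp.achievable hm⟩,
    fun hP => ⟨c.exists_isOptimal hP, fun p hp hm => hp.isOptimal_iff hP hm⟩,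
    fun hP hd hg p hp hm => ?_⟩
  rw [hp.isOptimal_iff hP hm]
  constructor
  · rintro ⟨lam, hl, h⟩
    have hl' := h.multiplier_pos hp.nonneg hl hg
    exact ⟨lam, hl', (hp.isStationary_iff_quadWater hd hl').1 h⟩
  · rintro ⟨lam, hl, h⟩
    exact ⟨lam, hl.le, (hp.isStationary_iff_quadWater hd hl).2 h⟩
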